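/- Let $p$ be a prime, $e\ge 1$, $q=p^e$. For $b\in\mathbb{F}_{q^6}$ let $$U_b=\{(x,\,bx^q+x^{q^4}) : x\in\mathbb{F}_{q^6}\},$$ an $\mathbb{F}_q$-subspace of $V=\mathbb{F}_{q^6}\times\mathbb{F}_{q^6}$. An $\mathbb{F}_q$-subspace $U$ of $V$ is called scattered if $\dim_{\mathbb{F}_q}(U\cap\langle v\rangle_{\mathbb{F}_{q^6}})\le 1$ for every nonzero $v\in V$, and maximum scattered if moreover $\dim_{\mathbb{F}_q}U=6$. Two $\mathbb{F}_q$-subspaces $U,W$ of $V$ are $\Gamma\mathrm{L}(2,q^6)$-equivalent if $\varphi(U)=W$ for some invertible $\mathbb{F}_{q^6}$-semilinear map $\varphi\colon V\to V$ (with respect to any automorphism of $\mathbb{F}_{q^6}$). Put $$\Gamma=\{b^{q^3+1} : b\in\mathbb{F}_{q^6},\ U_b\text{ is maximum scattered}\},$$ where $b^{q^3+1}=\mathrm{N}_{q^6/q^3}(b)$ is the norm of $b$ over $\mathbb{F}_{q^3}$. Then $$|\Gamma|=\left\lfloor\frac{(q^2+q+1)(q-2)}{2}\right\rfloor,$$ and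 the number of pairwise not $\Gamma\mathrm{L}(2,q^6)$-equivalent maximum scattered subspaces of the form $U_b$ (that is, the number of $\Gamma\mathrm{L}(2,q^6)$-equivalence classes of such subspaces) is at least $$\frac{|\Gamma|}{3e}=\frac{\lfloor (q^2+q+1)(q-2)/2\rfloor}{3e}.$$ -/

import Mathlib

/-- An `𝔽_q`-subspace `U` of an `𝔽_{q^n}`-vector space `V` (with `K = 𝔽_q`, `L = 𝔽_{q^n}`) is
scattered (with respect to the Desarguesian spread) if it meets every one-dimensional
`L`-subspace of `V` in an `𝔽_q`-subspace of dimension at most one. -/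
def IsScattered (K L : Type*) {V : Type*} [Field K] [Field L] [Algebra K L]
    [AddCommGroup V] [Module K V] [Module L V] [IsScalarTower K L V]
    (U : Submodule K V) : Prop :=
  ∀ v : V, v ≠ 0 →
    Module.finrank K ↥(U ⊓ (Submodule.span L {v}).restrictScalars K) ≤ 1

/-- `U` is maximum scattered if it is scattered and its `K`-dimension is half of the
`K`-dimension `r * n` of `V`. -/
def IsMaximumScattered (K L : Type*) {V : Type*} [Field K] [Field L] [Algebra K L]
    [AddCommGroup V] [Module K V] [Module L V] [IsScalarTower K L V]
    (U : Submodule K V) : Prop :=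
  IsScattered K L U ∧ 2 * Module.finrank K U = Module.finrank K V

/-- The `𝔽_q`-linear map `f_b(x) = b x^q + x^{q^4}` on `L`, where `q = |K|`. -/
def fMap (K : Type*) {L : Type*} [Field K] [Fintype K] [Field L] [Algebra K L]
    (b : L) : L →ₗ[K] L where
  toFun x := b * x ^ (Fintype.card K) + x ^ (Fintype.card K ^ 4)
  map_add' x y := by
    have h : ∀ u v : L, (u + v) ^ Fintype.card K = u ^ Fintype.card K + v ^ Fintype.card K :=
      fun u v => map_add (FiniteField.frobeniusAlgHom K L) u v
    have h4 : (x + y) ^ (Fintype.card K ^ 4)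
        = x ^ (Fintype.card K ^ 4) + y ^ (Fintype.card K ^ 4) := by
      simp only [pow_succ (Fintype.card K), pow_zero, one_mul, pow_mul, h]
    rw [h, h4]
    ring
  map_smul' c x := by
    have h : ∀ (c : K) (u : L), (c • u) ^ Fintype.card K = c • u ^ Fintype.card K :=
      fun c u => map_smul (FiniteField.frobeniusAlgHom K L) c u
    have h4 : (c • x) ^ (Fintype.card K ^ 4) = c • x ^ (Fintype.card K ^ 4) := by
      simp only [pow_succ (Fintype.card K), pow_zero, one_mul, pow_mul, h]
    rw [h, h4, RingHom.id_apply, smul_add, mul_smul_comm]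

/-- `U_b = {(x, b x^q + x^{q^4}) : x ∈ L}` as a `K`-subspace of `L × L`, where `q = |K|`. -/
def Ub (K : Type*) {L : Type*} [Field K] [Fintype K] [Field L] [Algebra K L]
    (b : L) : Submodule K (L × L) :=
  (fMap K b).graph

theorem coe_Ub (K : Type*) {L : Type*} [Field K] [Fintype K] [Field L] [Algebra K L] (b : L) :
    (Ub K b : Set (L × L)) =
      {v | ∃ x : L, v = (x, b * x ^ (Fintype.card K) + x ^ (Fintype.card K ^ 4))} := by
  ext ⟨x, y⟩
  constructor
  · intro h
    exact ⟨x, Prod.ext rfl h⟩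
  · rintro ⟨z, hz⟩
    obtain ⟨rfl, rfl⟩ := Prod.mk.inj hz
    exact (rfl : _ = _)

/-- The norm `N_{q^6/q^3}(x) = x^{(q^6-1)/(q^3-1)} = x^{q^3+1}`, for `q = |K|` and
`x ∈ L = 𝔽_{q^6}`. Its values lie in the subfield `𝔽_{q^3}` of `L`. -/
def normSixThree (K : Type*) {L : Type*} [Field K] [Fintype K] [Field L] (x : L) : L :=
  x ^ (Fintype.card K ^ 3 + 1)

/-- `Γ = {N_{q^6/q^3}(b) : U_b is maximum scattered}`. -/
def GammaSet (K L : Type*) [Field K] [Fintype K] [Field L] [Algebra K L] : Set L :=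
  {w | ∃ b : L, IsMaximumScattered K L (Ub K b) ∧ normSixThree K b = w}

/-- Two `K`-subspaces of `V` are `ΓL(V)`-equivalent, `V` an `L`-vector space, if some invertible
`L`-semilinear map of `V` (with respect to any automorphism of `L`) maps one onto the other. -/
def GammaLEquivalent (K L : Type*) {V : Type*} [Field K] [Field L]
    [AddCommGroup V] [Module K V] [Module L V] (U W : Submodule K V) : Prop :=
  ∃ (σ : L ≃+* L) (φ : V ≃+ V), (∀ (a : L) (v : V), φ (a • v) = σ a • φ v) ∧
    φ '' (U : Set V) = (W : Set V)

/-- The maximum scattered subspaces of `L × L` that are of the form `U_b`. -/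
def MaxScatteredUb (K L : Type*) [Field K] [Fintype K] [Field L] [Algebra K L] : Type _ :=
  {U : Submodule K (L × L) // IsMaximumScattered K L U ∧ ∃ b : L, U = Ub K b}

/-- `ΓL`-equivalence on the maximum scattered subspaces of the form `U_b`. -/
def gammaLSetoid (K L : Type*) [Field K] [Fintype K] [Field L] [Algebra K L] :
    Setoid (MaxScatteredUb K L) where
  r U W := GammaLEquivalent K L U.1 W.1
  iseqv :=
    { refl := fun U => ⟨RingEquiv.refl L, AddEquiv.refl (L × L), fun _ _ => rfl, by simp⟩
      symm := by
        rintro U W ⟨σ, φ, hφ, h⟩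
        refine ⟨σ.symm, φ.symm, fun a v => ?_, ?_⟩
        · apply φ.injective
          rw [hφ, φ.apply_symm_apply, φ.apply_symm_apply, σ.apply_symm_apply]
        · rw [← h, Set.image_image]
          simp
      trans := by
        rintro U W X ⟨σ, φ, hφ, h⟩ ⟨τ, ψ, hψ, k⟩
        refine ⟨σ.trans τ, φ.trans ψ, fun a v => ?_, ?_⟩
        · simp only [AddEquiv.trans_apply, RingEquiv.trans_apply, hφ, hψ]
        · rw [← k, ← h, Set.image_image]
          rfl }

/-- The number of pairwise not `ΓL`-equivalent maximum scattered subspaces of the form `U_b`,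
that is, the number of `ΓL`-equivalence classes of such subspaces. -/
noncomputable def numInequivalent (K L : Type*) [Field K] [Fintype K] [Field L] [Algebra K L] :
    ℕ :=
  Nat.card (Quotient (gammaLSetoid K L))

/-! Write σ for the q-Frobenius and N for the norm to 𝔽_{q³}. The subspace `U_b` fails to be
scattered exactly when b(σt − t)σx + (σ⁴t − t)σ⁴x = 0 for some t ∉ 𝔽_q and x ≠ 0. By Hilbert 90 for
𝔽_{q⁶}/𝔽_{q³}, such an x exists for a given t iff N(b) is the cross ratio `frobRatio K t`
(`isScattered_Ub_iff_frobRatio`). Hence Γ is the complement in 𝔽_{q³} of the set of these cross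
ratios (`gammaSet_eq`).

The value 0 comes from t ∈ 𝔽_{q²}, the value 1 from t ∈ 𝔽_{q³}, and all other values from generic t.
The cross ratio is invariant under PGL(2,q), which acts freely on generic t, and under t ↦ σ³t.
Conversely these symmetries explain every coincidence (`mobiusRel_of_frobRatio_eq`): if t and u have
equal cross ratios, then w = (1, t, u, tu), σw, σ³w, σ⁴w are coplanar points, so the line ⟨w, σ³w⟩
meets its conjugate. If the entries of w are independent over 𝔽_q, the three conjugates of this line
pass through a rational point, and such a point is a fractional linear relation between t and σ³u.

So a generic fibre consists of one or two orbits of size q³ − q. The one-orbit fibres are made of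
the t related to σ³t, counted by `ncard_selfPaired`. If I is the number of generic values, then 2I =
q³ + q² + q − 1, less 1 for q even, and |Γ| = q³ − 2 − I.

For the second claim, comparing coefficients of q-polynomials shows that equivalence of `U_b` and
`U_c` forces N(c) to be the image of N(b) under a field automorphism. An element of 𝔽_{q³} has at
most 3e such images. -/

/-- The `i`-th power of the `q`-Frobenius, `x ↦ x ^ (q ^ i)` with `q = |K|`. -/
noncomputable def frob (K : Type*) {R : Type*} [Field K] [Fintype K] [CommRing R] [Algebra K R]
    (i : ℕ) : R →ₐ[K] R :=
  FiniteField.frobeniusAlgHom K R ^ i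

/-! ### Powers of the q-Frobenius σ, root counts, and the Moore determinant argument. -/

section Frobenius

variable {K R : Type*} [Field K] [Fintype K] [CommRing R] [Algebra K R]

theorem frob_apply (i : ℕ) (x : R) : frob K i x = x ^ (Fintype.card K ^ i) := by
  rw [frob, AlgHom.coe_pow, FiniteField.coe_frobeniusAlgHom, pow_iterate]

theorem frob_zero (x : R) : frob K 0 x = x := by simp [frob_apply]

theorem frob_frob (i j : ℕ) (x : R) : frob K i (frob K j x) = frob K (i + j) x := by
  simp only [frob_apply, ← pow_mul, pow_add, mul_comm]

theorem frob_algebraMap (i : ℕ) (k : K) : frob K i (algebraMap K R k) = algebraMap K R k :=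
  (frob K i).commutes k

end Frobenius

section FrobeniusField

variable {K L : Type*} [Field K] [Fintype K] [Field L] [Algebra K L]

theorem frob_injective (i : ℕ) : Function.Injective (frob K i : L →ₐ[K] L) :=
  (frob K i : L →ₐ[K] L).toRingHom.injective

theorem frob_inj (i : ℕ) {x y : L} : frob K i x = frob K i y ↔ x = y :=
  (frob_injective i).eq_iff

theorem frob_eq_zero (i : ℕ) {x : L} : frob K i x = 0 ↔ x = 0 :=
  map_eq_zero _

theorem frob_one_eq_self_iff {x : L} : frob K 1 x = x ↔ ∃ k : K, algebraMap K L k = x := by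
  classical
  constructor
  · intro h
    let P : Polynomial L := Polynomial.X ^ Fintype.card K - Polynomial.X
    have hP : P ≠ 0 := FiniteField.X_pow_card_sub_X_ne_zero L Fintype.one_lt_card
    have hdeg : P.natDegree = Fintype.card K :=
      FiniteField.X_pow_card_sub_X_natDegree_eq L Fintype.one_lt_card
    let S : Finset L := Finset.univ.image (algebraMap K L)
    have hS : S.card = Fintype.card K :=
      Finset.card_image_of_injective _ (algebraMap K L).injective
    by_contra hx
    have hxS : x ∉ S := by simpa [S] using hx
    have hsub : (insert x S).val ⊆ P.roots := by
      intro y hy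
      rw [Finset.mem_val, Finset.mem_insert] at hy
      rw [Polynomial.mem_roots hP]
      rcases hy with rfl | hy
      · simpa [P, frob_apply, sub_eq_zero] using h
      · obtain ⟨k, -, rfl⟩ := Finset.mem_image.1 hy
        simp [P, ← map_pow, FiniteField.pow_card]
    have := Polynomial.card_le_degree_of_subset_roots hsub
    rw [Finset.card_insert_of_notMem hxS, hS, hdeg] at this
    omega
  · rintro ⟨k, rfl⟩
    exact frob_algebraMap 1 k

theorem frob_of_card {n : ℕ} [Finite L] (hL : Module.finrank K L = n) (x : L) :
    frob K n x = x := by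
  have := Fintype.ofFinite L
  rw [frob_apply, ← hL, ← Module.card_eq_pow_finrank, FiniteField.pow_card]

-- A divisor of `X ^ |L| - X` splits with simple roots, so the equations below are counted by
-- proving a divisibility.
open Polynomial in
theorem ncard_roots_of_dvd [Fintype L] {P : L[X]} (hP : P ∣ X ^ Fintype.card L - X) :
    {x : L | P.eval x = 0}.ncard = P.natDegree := by
  classical
  have h0 : (X ^ Fintype.card L - X : L[X]) ≠ 0 :=
    FiniteField.X_pow_card_sub_X_ne_zero L Fintype.one_lt_card
  have hP0 : P ≠ 0 := ne_zero_of_dvd_ne_zero h0 hP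
  have hroots := FiniteField.roots_X_pow_card_sub_X L
  have hs : (X ^ Fintype.card L - X : L[X]).Splits := by
    rw [splits_iff_card_roots, hroots,
      FiniteField.X_pow_card_sub_X_natDegree_eq L Fintype.one_lt_card]
    rfl
  have hnodup : P.roots.Nodup := by
    refine Multiset.nodup_of_le (roots.le_of_dvd h0 hP) ?_
    rw [hroots]
    exact Finset.univ.nodup
  rw [(hs.of_dvd h0 hP).natDegree_eq_card_roots, ← Multiset.toFinset_card_of_nodup hnodup,
    ← Set.ncard_coe_finset]
  congr 1
  ext x
  simp [hP0]

open Polynomial in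
theorem ncard_pow_eq [Fintype L] {d m : ℕ} (hd : d * m = Fintype.card L - 1)
    {c : L} (hc : c ^ m = 1) : {x : L | x ^ d = c}.ncard = d := by
  have hdvd : (X ^ d - C c : L[X]) ∣ X ^ Fintype.card L - X := by
    have h1 : (X ^ d - C c : L[X]) ∣ (X ^ d) ^ m - C c ^ m := sub_dvd_pow_sub_pow _ _ _
    rw [← pow_mul, hd, ← C_pow, hc, C_1] at h1
    refine h1.trans ⟨X, ?_⟩
    rw [sub_mul, one_mul, ← pow_succ, Nat.sub_add_cancel Fintype.card_pos]
  have := ncard_roots_of_dvd hdvd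
  rw [natDegree_X_pow_sub_C] at this
  simpa [sub_eq_zero] using this

open Polynomial in
theorem exists_pow_eq [Fintype L] {d m : ℕ} (hd : d * m = Fintype.card L - 1) (hd0 : 0 < d)
    {c : L} (hc : c ^ m = 1) : ∃ x : L, x ^ d = c := by
  have h := ncard_pow_eq hd hc
  exact Set.nonempty_of_ncard_ne_zero (by omega : {x : L | x ^ d = c}.ncard ≠ 0)

open Polynomial in
theorem ncard_frob_fixed [Fintype L] {i n : ℕ} (hi : 0 < i)
    (hL : Module.finrank K L = i * n) :
    {x : L | frob K i x = x}.ncard = Fintype.card K ^ i := by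
  have hq : 1 < Fintype.card K ^ i := Nat.one_lt_pow hi.ne' Fintype.one_lt_card
  have hdvd : (X ^ (Fintype.card K ^ i) - X : L[X]) ∣ X ^ Fintype.card L - X := by
    rw [Module.card_eq_pow_finrank (K := K) (V := L), hL, ← frob_apply, ← frob_apply]
    clear hL
    induction n with
    | zero => simp [frob_zero]
    | succ n ih =>
      -- Telescoping; `frob K (i * n)` applied to a polynomial is a power of that polynomial.
      have : frob K (i * (n + 1)) (X : L[X]) - X
          = frob K (i * n) (frob K i X - X) + (frob K (i * n) X - X) := by
        rw [map_sub, frob_frob]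
        ring_nf
      rw [this]
      refine dvd_add ?_ ih
      rw [frob_apply (i * n) (frob K i X - X)]
      exact dvd_pow_self _ (pow_pos Fintype.card_pos _).ne'
  have := ncard_roots_of_dvd hdvd
  rw [FiniteField.X_pow_card_sub_X_natDegree_eq L hq] at this
  rw [← this]
  simp [sub_eq_zero, frob_apply]

open Polynomial in
theorem ncard_frob_add [Fintype L] {i n : ℕ} (hi : 0 < i)
    (hL : Module.finrank K L = 2 * i * n) (c : K) :
    {x : L | frob K i x + x = algebraMap K L c}.ncard = Fintype.card K ^ i := by
  have hq : 1 < Fintype.card K ^ i := Nat.one_lt_pow hi.ne' Fintype.one_lt_card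
  set P : L[X] := X ^ (Fintype.card K ^ i) + (X - C (algebraMap K L c)) with hP
  have hP' : P = frob K i X + X - algebraMap K L[X] c := by
    rw [hP, frob_apply, IsScalarTower.algebraMap_apply K L L[X], algebraMap_eq]
    ring
  have hdvd : P ∣ X ^ Fintype.card L - X := by
    rw [Module.card_eq_pow_finrank (K := K) (V := L), hL, ← frob_apply]
    clear hL
    have h2 : P ∣ frob K (2 * i) X - X := by
      -- The constant `c` is fixed by σ^i, so it cancels in σ^i P − P.
      have : frob K (2 * i) X - X = frob K i P - P := by
        rw [hP', map_sub, map_add, frob_frob, frob_algebraMap, two_mul]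
        ring
      rw [this]
      refine dvd_sub ?_ dvd_rfl
      rw [frob_apply]
      exact dvd_pow_self _ (pow_pos Fintype.card_pos _).ne'
    induction n with
    | zero => simp [frob_zero]
    | succ n ih =>
      have : frob K (2 * i * (n + 1)) (X : L[X]) - X
          = frob K (2 * i * n) (frob K (2 * i) X - X) + (frob K (2 * i * n) X - X) := by
        rw [map_sub, frob_frob]
        ring_nf
      rw [this]
      refine dvd_add ?_ ih
      rw [frob_apply (2 * i * n) (frob K (2 * i) X - X)]
      exact h2.trans (dvd_pow_self _ (pow_pos Fintype.card_pos _).ne')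
  have := ncard_roots_of_dvd hdvd
  have hdeg : P.natDegree = Fintype.card K ^ i := by
    rw [hP, natDegree_add_eq_left_of_natDegree_lt, natDegree_X_pow]
    rw [natDegree_X_sub_C, natDegree_X_pow]
    exact hq
  rw [hdeg] at this
  rw [← this, hP']
  congr 1
  ext x
  simp [frob_apply, sub_eq_zero, IsScalarTower.algebraMap_apply K L L[X]]

open Polynomial in
/-- If `w 0, …, w (n - 1)` are linearly independent over `K`, the vectors
`(w j ^ (q ^ i))_j` for `i < n` are linearly independent over `L`. -/
theorem linearIndependent_frob {n : ℕ} {w : Fin n → L} (hw : LinearIndependent K w)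
    {c : Fin n → L} (h : ∀ j, ∑ i : Fin n, c i * frob K i (w j) = 0) : c = 0 := by
  classical
  -- If nonzero, this q-polynomial has degree at most q^(n−1), yet it vanishes on the K-span of `w`,
  -- which has q^n elements.
  let P : L[X] := ∑ i : Fin n, C (c i) * X ^ (Fintype.card K ^ (i : ℕ))
  have heval (x : L) : P.eval x = ∑ i : Fin n, c i * frob K i x := by
    simp [P, eval_finsetSum, frob_apply]
  by_cases hP : P = 0
  · ext i
    have := congrArg (fun p => p.coeff (Fintype.card K ^ (i : ℕ))) hP
    simpa [P, finsetSum_coeff, coeff_C_mul, coeff_X_pow,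
      (Nat.pow_right_injective (Fintype.one_lt_card (α := K))).eq_iff, Fin.val_inj] using this
  exfalso
  let φ : L →ₗ[K] L := ∑ i : Fin n, c i • (frob K i : L →ₐ[K] L).toLinearMap
  have hφ (x : L) : φ x = P.eval x := by
    rw [heval]
    simp [φ, LinearMap.sum_apply]
  let f : (Fin n → K) → L := fun a => ∑ j, a j • w j
  have hf : Function.Injective f := fun a b hab => by
    have := Fintype.linearIndependent_iff.1 hw (a - b) (by
      simp only [f] at hab
      simp [sub_smul, Finset.sum_sub_distrib, hab])
    funext j
    exact sub_eq_zero.1 (this j)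
  have hsub : (Finset.univ.image f).val ⊆ P.roots := by
    intro y hy
    obtain ⟨a, -, rfl⟩ := Finset.mem_image.1 (show y ∈ Finset.univ.image f from hy)
    rw [mem_roots hP, IsRoot, ← hφ]
    have hw0 (j) : φ (w j) = 0 := by rw [hφ, heval, h]
    simp only [f, map_sum, map_smul, hw0, smul_zero, Finset.sum_const_zero]
  have hcard := card_le_degree_of_subset_roots hsub
  rw [Finset.card_image_of_injective _ hf, Finset.card_univ, Fintype.card_fun,
    Fintype.card_fin] at hcard
  rcases n with _ | n
  · simp [P] at hP
  have hdeg : P.natDegree ≤ Fintype.card K ^ n := by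
    refine natDegree_sum_le_of_forall_le _ _ fun i _ => (natDegree_C_mul_X_pow_le _ _).trans ?_
    exact Nat.pow_le_pow_right Fintype.card_pos (by omega)
  have : Fintype.card K ^ n < Fintype.card K ^ (n + 1) :=
    Nat.pow_lt_pow_right Fintype.one_lt_card (by omega)
  omega

end FrobeniusField

/-! ### Three conjugate lines in projective 3-space. -/

section Incidence

variable {K L : Type*} [Field K] [Fintype K] [Field L] [Algebra K L]

/-- Let `w` have coordinates linearly independent over `K`, let `wᵢ` be its conjugates. If
`w₀, w₁, w₃, w₄` are linearly dependent then the span of `w₀` and `w₃` contains a nonzero vector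
with coordinates in `K`. -/
theorem exists_fixed_of_dependent (h6 : ∀ x : L, frob K 6 x = x) {w : Fin 4 → L}
    (hw : LinearIndependent K w) {c₀ c₁ c₃ c₄ : L}
    (hne : ¬ (c₀ = 0 ∧ c₁ = 0 ∧ c₃ = 0 ∧ c₄ = 0))
    (h : ∀ j, c₀ * w j + c₁ * frob K 1 (w j) + c₃ * frob K 3 (w j) + c₄ * frob K 4 (w j) = 0) :
    ∃ X : Fin 4 → K, X ≠ 0 ∧ ∃ l m : L, ∀ j,
      algebraMap K L (X j) = l * w j + m * frob K 3 (w j) := by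
  have hs : ∀ i (x : L), frob K (i + 6) x = frob K i x := fun i x => by rw [← frob_frob, h6]
  have h7 (x : L) : frob K 7 x = frob K 1 x := hs 1 x
  have h8 (x : L) : frob K 8 x = frob K 2 x := hs 2 x
  have M0 (a₀ a₁ a₂ a₃ : L) (ha : ∀ j, a₀ * w j + a₁ * frob K 1 (w j) + a₂ * frob K 2 (w j)
      + a₃ * frob K 3 (w j) = 0) : a₀ = 0 ∧ a₁ = 0 ∧ a₂ = 0 ∧ a₃ = 0 := by
    have := linearIndependent_frob hw (c := ![a₀, a₁, a₂, a₃]) (fun j => by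
      simpa [Fin.sum_univ_four, frob_zero] using ha j)
    exact ⟨congrFun this 0, congrFun this 1, congrFun this 2, congrFun this 3⟩
  -- Applying σ⁵ = σ⁻¹ moves the conjugates 1, …, 4 to 0, …, 3.
  have M1 (a₁ a₂ a₃ a₄ : L) (ha : ∀ j, a₁ * frob K 1 (w j) + a₂ * frob K 2 (w j)
      + a₃ * frob K 3 (w j) + a₄ * frob K 4 (w j) = 0) :
      a₁ = 0 ∧ a₂ = 0 ∧ a₃ = 0 ∧ a₄ = 0 := by
    have := M0 (frob K 5 a₁) (frob K 5 a₂) (frob K 5 a₃) (frob K 5 a₄) (fun j => by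
      have := congrArg (frob K 5) (ha j)
      simpa only [map_add, map_mul, frob_frob, Nat.reduceAdd, h6, h7, h8, hs 3, map_zero]
        using this)
    simpa only [frob_eq_zero] using this
  have hc0 : c₀ ≠ 0 := by
    rintro rfl
    have := M1 c₁ 0 c₃ c₄ (fun j => by linear_combination h j)
    tauto
  -- `X` is a common point of ℓ = ⟨w, σ³w⟩ and σℓ = ⟨σw, σ⁴w⟩. As σ⁶ = 1, the line ℓ is fixed by σ³,
  -- so each conjugate of `X` lies on two of ℓ, σℓ, σ²ℓ and has two expressions.
  let X : Fin 4 → L := fun j => c₀ * w j + c₃ * frob K 3 (w j)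
  have hX' (j) : X j = -(c₁ * frob K 1 (w j) + c₄ * frob K 4 (w j)) := by
    linear_combination h j
  have hX1 (j) : frob K 1 (X j) = frob K 1 c₀ * frob K 1 (w j) + frob K 1 c₃ * frob K 4 (w j) := by
    simp [X, frob_frob]
  have hX2 (j) : frob K 2 (X j) = -(frob K 2 c₁ * frob K 3 (w j) + frob K 2 c₄ * w j) := by
    rw [hX']
    simp only [map_neg, map_add, map_mul, frob_frob, Nat.reduceAdd, h6]
  have hX2' (j) : frob K 2 (X j) = frob K 2 c₀ * frob K 2 (w j) + frob K 2 c₃ * frob K 5 (w j) := by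
    simp [X, frob_frob]
  have hX3 (j) : frob K 3 (X j) = frob K 3 c₀ * frob K 3 (w j) + frob K 3 c₃ * w j := by
    simp [X, frob_frob, h6]
  have hX3' (j) :
      frob K 3 (X j) = -(frob K 3 c₁ * frob K 4 (w j) + frob K 3 c₄ * frob K 1 (w j)) := by
    rw [hX']
    simp only [map_neg, map_add, map_mul, frob_frob, Nat.reduceAdd, h7]
  have hX4 (j) : frob K 4 (X j) = frob K 4 c₀ * frob K 4 (w j) + frob K 4 c₃ * frob K 1 (w j) := by
    simp [X, frob_frob, h7]
  have hX4' (j) :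
      frob K 4 (X j) = -(frob K 4 c₁ * frob K 5 (w j) + frob K 4 c₄ * frob K 2 (w j)) := by
    rw [hX']
    simp only [map_neg, map_add, map_mul, frob_frob, Nat.reduceAdd, h8]
  -- the conjugates of order two are proportional
  have hD : c₃ * frob K 2 c₄ - c₀ * frob K 2 c₁ = 0 := by
    by_contra hD
    -- `D` is the determinant of `X` and σ²X in the basis w, σ³w of ℓ. If it is nonzero, the three
    -- lines lie in the span of X, σX, σ²X, which then contains the four independent vectors w, σw,
    -- σ²w, σ³w.
    set D := c₃ * frob K 2 c₄ - c₀ * frob K 2 c₁ with hDdef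
    have hD1 : frob K 1 D ≠ 0 := (frob_eq_zero 1).not.2 hD
    have hD2 : frob K 2 D ≠ 0 := (frob_eq_zero 2).not.2 hD
    have hD1' : frob K 1 D = frob K 1 c₃ * frob K 3 c₄ - frob K 1 c₀ * frob K 3 c₁ := by
      simp [hDdef, frob_frob]
    have hD2' : frob K 2 D = frob K 2 c₃ * frob K 4 c₄ - frob K 2 c₀ * frob K 4 c₁ := by
      simp [hDdef, frob_frob]
    let b : Fin 3 → Fin 4 → L := ![X, fun j => frob K 1 (X j), fun j => frob K 2 (X j)]
    let S := Submodule.span L (Set.range b)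
    have b0 : X ∈ S := Submodule.subset_span ⟨0, rfl⟩
    have b1 : (fun j => frob K 1 (X j)) ∈ S := Submodule.subset_span ⟨1, rfl⟩
    have b2 : (fun j => frob K 2 (X j)) ∈ S := Submodule.subset_span ⟨2, rfl⟩
    have comb (d : L) (hd : d ≠ 0) (u x y : Fin 4 → L) (hx : x ∈ S) (hy : y ∈ S) (a a' : L)
        (hu : ∀ j, d * u j = a * x j + a' * y j) : u ∈ S := by
      have : u = d⁻¹ • (a • x + a' • y) := by
        ext j
        simp only [Pi.smul_apply, Pi.add_apply, smul_eq_mul, ← hu]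
        field_simp
      rw [this]
      exact S.smul_mem _ (S.add_mem (S.smul_mem _ hx) (S.smul_mem _ hy))
    have v0 : w ∈ S := comb D hD _ _ _ b0 b2 (-frob K 2 c₁) (-c₃) fun j => by
      rw [hX2]; simp only [X]; ring
    have v3 : (fun j => frob K 3 (w j)) ∈ S := comb D hD _ _ _ b0 b2 (frob K 2 c₄) c₀ fun j => by
      rw [hX2]; simp only [X]; ring
    have b3 : (fun j => frob K 3 (X j)) ∈ S :=
      comb 1 one_ne_zero _ _ _ v3 v0 (frob K 3 c₀) (frob K 3 c₃) fun j => by rw [hX3]; ring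
    have v1 : (fun j => frob K 1 (w j)) ∈ S :=
      comb _ hD1 _ _ _ b1 b3 (-frob K 3 c₁) (-frob K 1 c₃) fun j => by
        rw [hX3', hX1, hD1']; ring
    have v4 : (fun j => frob K 4 (w j)) ∈ S :=
      comb _ hD1 _ _ _ b1 b3 (frob K 3 c₄) (frob K 1 c₀) fun j => by
        rw [hX3', hX1, hD1']; ring
    have b4 : (fun j => frob K 4 (X j)) ∈ S :=
      comb 1 one_ne_zero _ _ _ v4 v1 (frob K 4 c₀) (frob K 4 c₃) fun j => by rw [hX4]; ring
    have v2 : (fun j => frob K 2 (w j)) ∈ S :=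
      comb _ hD2 _ _ _ b2 b4 (-frob K 4 c₁) (-frob K 2 c₃) fun j => by
        rw [hX4', hX2', hD2']; ring
    have hli : LinearIndependent L (fun (i : Fin 4) (j : Fin 4) => frob K (i : ℕ) (w j)) := by
      rw [Fintype.linearIndependent_iff]
      intro g hg
      have := linearIndependent_frob hw (c := g) (fun j => by
        simpa using congrFun hg j)
      exact fun i => congrFun this i
    have htop := hli.span_eq_top_of_card_eq_finrank (by simp)
    have hle : (⊤ : Submodule L (Fin 4 → L)) ≤ S := by
      rw [← htop, Submodule.span_le]
      rintro _ ⟨i, rfl⟩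
      fin_cases i
      · simpa [frob_zero] using v0
      · exact v1
      · exact v2
      · exact v3
    have hfin : Module.finrank L S ≤ 3 := by
      simpa [Set.finrank] using finrank_range_le_card (R := L) b
    rw [top_le_iff.1 hle, finrank_top, Module.finrank_fin_fun] at hfin
    omega
  -- Both `X` and σ³X lie on ℓ ∩ σℓ, which is a single point because w₁, w₃, w₄ are independent.
  have hE : c₀ * frob K 3 c₀ - c₃ * frob K 3 c₃ = 0 := by
    refine (M1 (c₀ * frob K 3 c₄ - frob K 3 c₃ * c₁) 0 (c₀ * frob K 3 c₀ - c₃ * frob K 3 c₃)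
      (c₀ * frob K 3 c₁ - frob K 3 c₃ * c₄) fun j => ?_).2.2.1
    have e3 := hX3 j
    rw [hX3'] at e3
    linear_combination -frob K 3 c₃ * hX' j - c₀ * e3
  obtain ⟨j₀, hj₀⟩ : ∃ j, X j ≠ 0 := by
    by_contra! hX
    exact hc0 (M0 c₀ 0 0 c₃ fun j => by linear_combination hX j).1
  have p2 (j) : frob K 2 (X j) * X j₀ = X j * frob K 2 (X j₀) := by
    have key (j) : c₀ * frob K 2 (X j) = -frob K 2 c₄ * X j := by
      rw [hX2]; simp only [X]; linear_combination frob K 3 (w j) * hD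
    apply mul_left_cancel₀ hc0
    linear_combination X j₀ * key j - X j * key j₀
  have p3 (j) : frob K 3 (X j) * X j₀ = X j * frob K 3 (X j₀) := by
    have key (j) : c₀ * frob K 3 (X j) = frob K 3 c₃ * X j := by
      rw [hX3]; simp only [X]; linear_combination frob K 3 (w j) * hE
    apply mul_left_cancel₀ hc0
    linear_combination X j₀ * key j - X j * key j₀
  have p2' (j) : frob K 2 (X j / X j₀) = X j / X j₀ := by
    rw [map_div₀, div_eq_div_iff ((frob_eq_zero 2).not.2 hj₀) hj₀, p2]
  have p3' (j) : frob K 3 (X j / X j₀) = X j / X j₀ := by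
    rw [map_div₀, div_eq_div_iff ((frob_eq_zero 3).not.2 hj₀) hj₀, p3]
  -- What is fixed by σ² and by σ³ is fixed by σ, so the scaled point is rational.
  have p1' (j) : frob K 1 (X j / X j₀) = X j / X j₀ := by
    conv_lhs => rw [← p2' j, frob_frob]
    exact p3' j
  choose Y hY using fun j => frob_one_eq_self_iff.1 (p1' j)
  refine ⟨Y, fun h0 => ?_, c₀ / X j₀, c₃ / X j₀, fun j => ?_⟩
  · have := hY j₀
    rw [h0, div_self hj₀] at this
    simp at this
  · rw [hY]
    simp only [X]
    ring

end Incidence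

/-! ### Fractional linear transformations over K and the cross ratio. -/

section MobiusRel

variable {K L : Type*} [Field K] [Field L] [Algebra K L]

/-- `u` is the image of `t` under a fractional linear transformation over `K`. -/
def MobiusRel (K : Type*) {L : Type*} [Field K] [Field L] [Algebra K L] (t u : L) : Prop :=
  ∃ a b c d : K, a * d - b * c ≠ 0 ∧
    u * (algebraMap K L c * t + algebraMap K L d) = algebraMap K L a * t + algebraMap K L b

theorem MobiusRel.symm {t u : L} (h : MobiusRel K t u) : MobiusRel K u t := by
  obtain ⟨a, b, c, d, hD, h⟩ := h
  refine ⟨d, -b, -c, a, fun h0 => hD (by linear_combination h0), ?_⟩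
  simp only [map_neg]
  linear_combination -h

end MobiusRel

section Mobius

variable {K L : Type*} [Field K] [Fintype K] [Field L] [Algebra K L]

/-- The cross ratio of `t`, `t ^ (q ^ 3)`, `t ^ q`, `t ^ (q ^ 4)`. -/
noncomputable def frobRatio (K : Type*) {L : Type*} [Field K] [Fintype K] [Field L] [Algebra K L]
    (t : L) : L :=
  (frob K 4 t - t) * (frob K 1 t - frob K 3 t) / ((frob K 1 t - t) * (frob K 4 t - frob K 3 t))

/-- `t` is fixed neither by the second nor by the third power of the Frobenius. -/
def FrobGeneric (K : Type*) {L : Type*} [Field K] [Fintype K] [Field L] [Algebra K L]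
    (t : L) : Prop :=
  frob K 2 t ≠ t ∧ frob K 3 t ≠ t

theorem eq_zero_of_frob_one_ne {t : L} (ht : frob K 1 t ≠ t) {b c : K}
    (h : algebraMap K L b * t + algebraMap K L c = 0) : b = 0 ∧ c = 0 := by
  have h1 := congrArg (frob K 1) h
  simp only [map_add, map_mul, frob_algebraMap, map_zero] at h1
  have hb : algebraMap K L b = 0 := by
    have : algebraMap K L b * (frob K 1 t - t) = 0 := by linear_combination h1 - h
    exact (mul_eq_zero.1 this).resolve_right (sub_ne_zero.2 ht)
  rw [hb, zero_mul, zero_add] at h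
  exact ⟨by simpa using hb, by simpa using h⟩

theorem frob_one_ne_of_frob_two_ne {t : L} (ht : frob K 2 t ≠ t) : frob K 1 t ≠ t := fun h =>
  ht (by rw [← frob_frob 1 1, h, h])

/-- Such a `t` has degree over K greater than 2; the coefficients are isolated by applying σ and
subtracting, twice. -/
theorem eq_zero_of_frob_two_ne {t : L} (ht : frob K 2 t ≠ t) {a b c : K}
    (h : algebraMap K L a * t ^ 2 + algebraMap K L b * t + algebraMap K L c = 0) :
    a = 0 ∧ b = 0 ∧ c = 0 := by
  have ht1 := frob_one_ne_of_frob_two_ne ht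
  have h1 := congrArg (frob K 1) h
  simp only [map_add, map_mul, map_pow, frob_algebraMap, map_zero] at h1
  have h2 : algebraMap K L a * (frob K 1 t + t) + algebraMap K L b = 0 := by
    have : (frob K 1 t - t) * (algebraMap K L a * (frob K 1 t + t) + algebraMap K L b) = 0 := by
      linear_combination h1 - h
    exact (mul_eq_zero.1 this).resolve_left (sub_ne_zero.2 ht1)
  have h3 := congrArg (frob K 1) h2
  simp only [map_add, map_mul, frob_frob, frob_algebraMap, map_zero, Nat.reduceAdd] at h3
  have ha : a = 0 := by
    have : algebraMap K L a * (frob K 2 t - t) = 0 := by linear_combination h3 - h2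
    simpa using (mul_eq_zero.1 this).resolve_right (sub_ne_zero.2 ht)
  subst ha
  rw [map_zero, zero_mul, zero_add] at h
  exact ⟨rfl, eq_zero_of_frob_one_ne ht1 h⟩

theorem FrobGeneric.one_ne {t : L} (ht : FrobGeneric K t) : frob K 1 t ≠ t :=
  frob_one_ne_of_frob_two_ne ht.1

theorem FrobGeneric.four_ne (h6 : ∀ x : L, frob K 6 x = x) {t : L} (ht : FrobGeneric K t) :
    frob K 4 t ≠ t := fun h =>
  ht.1 (by rw [← h6 (frob K 2 t), frob_frob, ← frob_frob 4 4, h, h])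

theorem FrobGeneric.frob_three (h6 : ∀ x : L, frob K 6 x = x) {t : L} (ht : FrobGeneric K t) :
    FrobGeneric K (frob K 3 t) := by
  refine ⟨fun h => ht.1 ?_, fun h => ht.2 ?_⟩
  · rw [frob_frob, add_comm, ← frob_frob, frob_inj] at h
    exact h
  · rw [frob_frob, h6] at h
    exact h.symm

theorem MobiusRel.den_ne {t : L} (ht : frob K 1 t ≠ t) {a b c d : K} (hD : a * d - b * c ≠ 0) :
    algebraMap K L c * t + algebraMap K L d ≠ 0 := fun h => by
  obtain ⟨rfl, rfl⟩ := eq_zero_of_frob_one_ne ht h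
  simp at hD

theorem MobiusRel.trans {t u v : L} (ht : frob K 1 t ≠ t) (h : MobiusRel K t u)
    (h' : MobiusRel K u v) : MobiusRel K t v := by
  obtain ⟨a, b, c, d, hD, h⟩ := h
  obtain ⟨a', b', c', d', hD', h'⟩ := h'
  refine ⟨a' * a + b' * c, a' * b + b' * d, c' * a + d' * c, c' * b + d' * d,
    fun h0 => mul_ne_zero hD hD' (by linear_combination h0), ?_⟩
  have hn : algebraMap K L c * t + algebraMap K L d ≠ 0 := MobiusRel.den_ne ht hD
  apply mul_left_cancel₀ hn
  simp only [map_add, map_mul]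
  linear_combination (algebraMap K L c * t + algebraMap K L d) ^ 2 * h'
    - v * algebraMap K L c' * (algebraMap K L c * t + algebraMap K L d) * h
    + algebraMap K L a' * (algebraMap K L c * t + algebraMap K L d) * h

theorem MobiusRel.map_frob {t u : L} (h : MobiusRel K t u) (i : ℕ) :
    MobiusRel K (frob K i t) (frob K i u) := by
  obtain ⟨a, b, c, d, hD, h⟩ := h
  exact ⟨a, b, c, d, hD, by simpa [frob_algebraMap] using congrArg (frob K i) h⟩

/-- The factor is the determinant `e` over the two denominators. In a cross ratio all these factors
cancel. -/
theorem MobiusRel.exists_sub {t u : L} (ht : frob K 1 t ≠ t) (h : MobiusRel K t u) :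
    ∃ (e : L) (r : ℕ → L), e ≠ 0 ∧ (∀ i, r i ≠ 0) ∧ ∀ i j,
      frob K i u - frob K j u = e * (frob K i t - frob K j t) / (r i * r j) := by
  obtain ⟨a, b, c, d, hD, h⟩ := h
  have hr (i) : algebraMap K L c * frob K i t + algebraMap K L d ≠ 0 := by
    refine MobiusRel.den_ne (fun h => ht ?_) hD
    rwa [frob_frob, add_comm, ← frob_frob, frob_inj] at h
  have hu (i) : frob K i u = (algebraMap K L a * frob K i t + algebraMap K L b) /
      (algebraMap K L c * frob K i t + algebraMap K L d) := by
    rw [eq_div_iff (hr i)]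
    simpa [frob_algebraMap] using congrArg (frob K i) h
  refine ⟨algebraMap K L (a * d - b * c), fun i => algebraMap K L c * frob K i t + algebraMap K L d,
    (map_ne_zero _).2 hD, hr, fun i j => ?_⟩
  rw [hu, hu, div_sub_div _ _ (hr i) (hr j)]
  simp only [map_sub, map_mul]
  ring

theorem MobiusRel.frobGeneric {t u : L} (ht : FrobGeneric K t) (h : MobiusRel K t u) :
    FrobGeneric K u := by
  obtain ⟨e, r, he, hr, hs⟩ := h.exists_sub ht.one_ne
  have key (i) (hi : frob K i t ≠ t) : frob K i u ≠ u := by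
    rw [← sub_ne_zero]
    have := hs i 0
    rw [frob_zero, frob_zero] at this
    rw [this]
    exact div_ne_zero (mul_ne_zero he (sub_ne_zero.2 hi)) (mul_ne_zero (hr _) (hr _))
  exact ⟨key 2 ht.1, key 3 ht.2⟩

theorem MobiusRel.frobRatio_eq {t u : L} (ht : frob K 1 t ≠ t) (h : MobiusRel K t u) :
    frobRatio K u = frobRatio K t := by
  obtain ⟨e, r, he, hr, hs⟩ := h.exists_sub ht
  have hs0 (i) := hs i 0
  simp only [frob_zero] at hs0
  rw [frobRatio, frobRatio, hs0, hs0, hs, hs]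
  have := hr 0
  have := hr 1
  have := hr 3
  have := hr 4
  have h1 : frob K 1 t - t ≠ 0 := sub_ne_zero.2 ht
  have h4 : frob K 4 t - frob K 3 t ≠ 0 := by
    rw [sub_ne_zero, show 4 = 3 + 1 from rfl, ← frob_frob, Ne, frob_inj]
    exact ht
  field_simp

theorem frobRatio_frob_three (h6 : ∀ x : L, frob K 6 x = x) (t : L) :
    frobRatio K (frob K 3 t) = frobRatio K t := by
  have h7 : frob K 7 t = frob K 1 t := by rw [← frob_frob 1 6, h6]
  rw [frobRatio, frobRatio]
  simp only [frob_frob, Nat.reduceAdd, h6, h7]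
  ring

theorem frob_three_frobRatio (h6 : ∀ x : L, frob K 6 x = x) (t : L) :
    frob K 3 (frobRatio K t) = frobRatio K t := by
  rw [← frobRatio_frob_three h6 t]
  have h7 : frob K 7 t = frob K 1 t := by rw [← frob_frob 1 6, h6]
  rw [frobRatio]
  simp only [map_div₀, map_mul, map_sub, frob_frob, Nat.reduceAdd, h6, h7]
  ring

/-- A degenerate bilinear relation would split into factors linear in `t` or in `u` alone,
impossible outside K. -/
theorem mobiusRel_of_dependent {t u : L} (ht : frob K 1 t ≠ t) (hu : frob K 1 u ≠ u)
    {a b c d : K} (hne : ¬ (a = 0 ∧ b = 0 ∧ c = 0 ∧ d = 0))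
    (h : algebraMap K L a + algebraMap K L b * t + algebraMap K L c * u
      + algebraMap K L d * (t * u) = 0) : MobiusRel K t u := by
  refine ⟨-b, -a, d, c, fun hD => hne ?_, by simp only [map_neg]; linear_combination h⟩
  by_cases hd : d = 0
  · subst hd
    have hbc : b * c = 0 := by linear_combination -hD
    rcases mul_eq_zero.1 hbc with rfl | rfl
    · have := eq_zero_of_frob_one_ne hu (b := c) (c := a) (by
        simp only [map_zero] at h; linear_combination h)
      tauto
    · have := eq_zero_of_frob_one_ne ht (b := b) (c := a) (by
        simp only [map_zero] at h; linear_combination h)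
      tauto
  · exfalso
    have hDL := congrArg (algebraMap K L) hD
    simp only [map_sub, map_mul, map_neg, map_zero] at hDL
    have : (algebraMap K L d * u + algebraMap K L b) * (algebraMap K L d * t + algebraMap K L c)
        = 0 := by
      linear_combination algebraMap K L d * h - hDL
    rcases mul_eq_zero.1 this with h | h
    · exact hd (eq_zero_of_frob_one_ne hu h).1
    · exact hd (eq_zero_of_frob_one_ne ht h).1

/-- The cross ratio determines `t` up to fractional linear transformations over `K` and
`t ↦ t ^ (q ^ 3)`. -/
theorem mobiusRel_of_frobRatio_eq (h6 : ∀ x : L, frob K 6 x = x) {t u : L}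
    (ht : FrobGeneric K t) (hu : FrobGeneric K u) (h : frobRatio K t = frobRatio K u) :
    MobiusRel K t u ∨ MobiusRel K t (frob K 3 u) := by
  by_cases hw : LinearIndependent K ![1, t, u, t * u]
  swap
  -- A K-linear relation among 1, t, u, tu is already a fractional linear relation between `t` and
  -- `u`.
  · left
    rw [Fintype.linearIndependent_iff] at hw
    push Not at hw
    obtain ⟨g, hg, i, hi⟩ := hw
    refine mobiusRel_of_dependent (a := g 0) (b := g 1) (c := g 2) (d := g 3) ht.one_ne hu.one_ne
      ?_ ?_
    · rintro ⟨h0, h1, h2, h3⟩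
      fin_cases i <;> simp_all
    · simpa [Fin.sum_univ_four, Algebra.smul_def] using hg
  right
  have d1 : (frob K 1 t - t) * (frob K 4 t - frob K 3 t) ≠ 0 := by
    refine mul_ne_zero (sub_ne_zero.2 ht.one_ne) ?_
    rw [sub_ne_zero, show 4 = 3 + 1 from rfl, ← frob_frob, Ne, frob_inj]
    exact ht.one_ne
  have d2 : (frob K 1 u - u) * (frob K 4 u - frob K 3 u) ≠ 0 := by
    refine mul_ne_zero (sub_ne_zero.2 hu.one_ne) ?_
    rw [sub_ne_zero, show 4 = 3 + 1 from rfl, ← frob_frob, Ne, frob_inj]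
    exact hu.one_ne
  rw [frobRatio, frobRatio, div_eq_div_iff d1 d2] at h
  -- The rows are the conjugates of (1, t, u, tu) under 1, σ, σ³, σ⁴; the determinant vanishes by
  -- the cross-multiplied equality of cross ratios.
  let A : Matrix (Fin 4) (Fin 4) L := !![1, t, u, t * u;
    1, frob K 1 t, frob K 1 u, frob K 1 t * frob K 1 u;
    1, frob K 3 t, frob K 3 u, frob K 3 t * frob K 3 u;
    1, frob K 4 t, frob K 4 u, frob K 4 t * frob K 4 u]
  have hdet : A.det = 0 := by
    simp only [A, Matrix.det_succ_row_zero, Fin.sum_univ_succ]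
    simp [Fin.succAbove]
    linear_combination h
  obtain ⟨c, hc, hcA⟩ := Matrix.exists_vecMul_eq_zero_iff.2 hdet
  obtain ⟨X, hX, l, m, hlm⟩ := exists_fixed_of_dependent h6 hw (c₀ := c 0) (c₁ := c 1) (c₃ := c 2)
    (c₄ := c 3) (by
      rintro ⟨h0, h1, h2, h3⟩
      apply hc
      ext i
      fin_cases i <;> assumption) (by
      intro j
      have := congrFun hcA j
      fin_cases j <;> simpa [A, Matrix.vecMul, dotProduct, Fin.sum_univ_four] using this)
  have x0 := hlm 0
  have x1 := hlm 1
  have x2 := hlm 2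
  have x3 := hlm 3
  simp [Matrix.cons_val_zero] at x0 x1 x2 x3
  -- The linear form X₃ − t X₂ − σ³u X₁ + t σ³u X₀ vanishes at (1, t, u, tu) and at its
  -- σ³-conjugate, hence at `X`.
  refine mobiusRel_of_dependent (a := X 3) (b := -X 2) (c := -X 1) (d := X 0) ht.one_ne
    (hu.frob_three h6).one_ne ?_ ?_
  · rintro ⟨h3, h2, h1, h0⟩
    apply hX
    ext i
    fin_cases i <;> simp_all
  · simp only [map_neg, x0, x1, x2, x3]
    ring

/-- PGL(2,q) acts freely on elements of degree above 2. Its normal forms a t + b and b + a/(t + d),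
with a ≠ 0, contribute q(q − 1) and q²(q − 1) images. -/
theorem ncard_setOf_mobiusRel {t : L} (ht : frob K 2 t ≠ t) :
    {u : L | MobiusRel K t u}.ncard = Fintype.card K ^ 3 - Fintype.card K := by
  classical
  have ht1 := frob_one_ne_of_frob_two_ne ht
  let f : (Kˣ × K) ⊕ (Kˣ × K × K) → L := Sum.elim
    (fun x => algebraMap K L x.1 * t + algebraMap K L x.2)
    (fun x => algebraMap K L x.2.1 + algebraMap K L x.1 / (t + algebraMap K L x.2.2))
  have hden (d : K) : t + algebraMap K L d ≠ 0 := fun h => by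
    have := eq_zero_of_frob_one_ne ht1 (b := 1) (c := d) (by simpa using h)
    exact one_ne_zero this.1
  have hmixed (x : Kˣ × K) (y : Kˣ × K × K) : algebraMap K L x.1 * t + algebraMap K L x.2 ≠
      algebraMap K L y.2.1 + algebraMap K L y.1 / (t + algebraMap K L y.2.2) := fun h => by
    have h0 := hden y.2.2
    field_simp at h
    have := eq_zero_of_frob_two_ne ht (a := x.1) (b := x.1 * y.2.2 + x.2 - y.2.1)
      (c := x.2 * y.2.2 - y.2.1 * y.2.2 - y.1) (by
        simp only [map_add, map_sub, map_mul]; linear_combination h)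
    exact x.1.ne_zero this.1
  have hf : Function.Injective f := by
    rintro (⟨a, b⟩ | ⟨a, b, d⟩) (⟨a', b'⟩ | ⟨a', b', d'⟩) h
    · simp only [f, Sum.elim_inl] at h
      have := eq_zero_of_frob_one_ne ht1 (b := a - a') (c := b - b') (by
        simp only [map_sub]; linear_combination h)
      rw [sub_eq_zero, sub_eq_zero, Units.val_inj] at this
      rw [this.1, this.2]
    · exact (hmixed _ _ h).elim
    · exact (hmixed _ _ h.symm).elim
    · simp only [f, Sum.elim_inr] at h
      have h0 := hden d
      have h0' := hden d'
      field_simp at h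
      have := eq_zero_of_frob_two_ne ht (a := b - b') (b := (b - b') * (d + d') + a - a')
        (c := (b - b') * d * d' + a * d' - a' * d) (by
          simp only [map_add, map_sub, map_mul]; linear_combination h)
      obtain ⟨hb, ha, hd⟩ := this
      rw [sub_eq_zero] at hb
      subst hb
      have ha : (a : K) = a' := by linear_combination ha
      rw [Units.val_inj] at ha
      subst ha
      have hd : (a : K) * (d' - d) = 0 := by linear_combination hd
      have hd := (mul_eq_zero.1 hd).resolve_left a.ne_zero
      rw [sub_eq_zero] at hd
      rw [hd]
  have hrange : {u : L | MobiusRel K t u} = Set.range f := by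
    ext u
    constructor
    · rintro ⟨a, b, c, d, hD, h⟩
      by_cases hc : c = 0
      · subst hc
        have hd : d ≠ 0 := by rintro rfl; simp at hD
        have ha : a ≠ 0 := by rintro rfl; simp at hD
        refine ⟨Sum.inl (Units.mk0 (a / d) (div_ne_zero ha hd), b / d), ?_⟩
        have hd' : algebraMap K L d ≠ 0 := by simpa using hd
        simp only [f, Sum.elim_inl, Units.val_mk0, map_div₀]
        rw [map_zero, zero_mul, zero_add] at h
        field_simp
        linear_combination -h
      · refine ⟨Sum.inr (Units.mk0 (-(a * d - b * c) / c ^ 2)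
          (div_ne_zero (neg_ne_zero.2 hD) (pow_ne_zero _ hc)), a / c, d / c), ?_⟩
        have hc' : algebraMap K L c ≠ 0 := by simpa using hc
        have h0 := hden (d / c)
        have h1 : algebraMap K L c * t + algebraMap K L d ≠ 0 := MobiusRel.den_ne ht1 hD
        simp only [f, Sum.elim_inr, Units.val_mk0, map_div₀, map_neg, map_sub, map_mul, map_pow]
          at h0 ⊢
        rw [← eq_div_iff h1] at h
        rw [h]
        field_simp
        ring
    · rintro ⟨⟨a, b⟩ | ⟨a, b, d⟩, rfl⟩
      · exact ⟨a, b, 0, 1, by simp, by simp [f]⟩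
      · refine ⟨b, b * d + a, 1, d, by simp, ?_⟩
        have h0 := hden d
        simp only [f, Sum.elim_inr, map_one, map_add, map_mul]
        field_simp
        ring
  rw [hrange, ← Nat.card_coe_set_eq, Nat.card_range_of_injective hf, Nat.card_eq_fintype_card]
  simp only [Fintype.card_sum, Fintype.card_prod, Fintype.card_units]
  obtain ⟨n, hn⟩ : ∃ n, Fintype.card K = n + 1 := ⟨_, (Nat.sub_add_cancel Fintype.card_pos).symm⟩
  rw [hn, Nat.add_sub_cancel]
  symm
  rw [Nat.sub_eq_iff_eq_add (Nat.le_self_pow (by norm_num) _)]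
  ring

end Mobius

theorem pow_three_add_one_mul (q : ℕ) :
    (q ^ 3 + 1) * (q ^ 3 - 1) = q ^ 6 - 1 := by
  rw [← Nat.sq_sub_sq, ← pow_mul, one_pow]

/-! ### Counting generic elements, self-paired elements and generic cross ratios. -/

section Counting

variable {K L : Type*} [Field K] [Fintype K] [Field L] [Algebra K L]

theorem frob_six (hL : Module.finrank K L = 6) (x : L) : frob K 6 x = x :=
  have := Module.finite_of_finrank_pos (R := K) (M := L) (by omega)
  have := Module.finite_of_finite K (M := L)
  frob_of_card hL x

theorem card_eq_pow_six [Fintype L] (hL : Module.finrank K L = 6) :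
    Fintype.card L = Fintype.card K ^ 6 := by
  rw [Module.card_eq_pow_finrank (K := K), hL]

theorem ncard_frobGeneric [Fintype L] (hL : Module.finrank K L = 6) :
    {t : L | FrobGeneric K t}.ncard + Fintype.card K ^ 2 + Fintype.card K ^ 3
      = Fintype.card K ^ 6 + Fintype.card K := by
  have h2 := ncard_frob_fixed (K := K) (L := L) (i := 2) (n := 3) (by norm_num) hL
  have h3 := ncard_frob_fixed (K := K) (L := L) (i := 3) (n := 2) (by norm_num) hL
  have h1 := ncard_frob_fixed (K := K) (L := L) (i := 1) (n := 6) (by norm_num) hL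
  have hinter : {x : L | frob K 2 x = x} ∩ {x : L | frob K 3 x = x} = {x : L | frob K 1 x = x} := by
    ext x
    constructor
    · rintro ⟨hx2, hx3⟩
      rw [Set.mem_ofPred_eq] at *
      conv_lhs => rw [← hx2, frob_frob]
      exact hx3
    · intro hx
      rw [Set.mem_ofPred_eq] at hx
      have hx2 : frob K 2 x = x := by rw [← frob_frob 1 1, hx, hx]
      exact ⟨hx2, by rw [Set.mem_ofPred_eq, ← frob_frob 1 2, hx2, hx]⟩
  have hunion := Set.ncard_union_add_ncard_inter {x : L | frob K 2 x = x} {x : L | frob K 3 x = x}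
  rw [hinter, h1, h2, h3, pow_one] at hunion
  have hcompl : {t : L | FrobGeneric K t}
      = ({x : L | frob K 2 x = x} ∪ {x : L | frob K 3 x = x})ᶜ := by
    ext x
    simp [FrobGeneric]
  have hc := Set.ncard_add_ncard_compl ({x : L | frob K 2 x = x} ∪ {x : L | frob K 3 x = x})
  rw [← hcompl, Nat.card_eq_fintype_card, card_eq_pow_six hL] at hc
  omega

theorem algebraMap_pow_card_pow_sub_one {c : K} (hc : c ≠ 0) (i : ℕ) :
    algebraMap K L c ^ (Fintype.card K ^ i - 1) = 1 := by
  have hc' : algebraMap K L c ≠ 0 := by simpa using hc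
  apply mul_right_cancel₀ hc'
  rw [← pow_succ, Nat.sub_add_cancel (Nat.one_le_pow _ _ Fintype.card_pos), ← frob_apply,
    frob_algebraMap, one_mul]

/-- Of the q³ + 1 solutions of σ³u · u = c, the non-generic ones are exactly the q + 1 solutions of
σu · u = c, all fixed by σ². -/
theorem ncard_frobGeneric_norm [Fintype L] (hL : Module.finrank K L = 6) {c : K} (hc : c ≠ 0) :
    {u : L | FrobGeneric K u ∧ frob K 3 u * u = algebraMap K L c}.ncard
      = Fintype.card K ^ 3 - Fintype.card K := by
  set q := Fintype.card K with hq
  have hq1 : 1 ≤ q := Fintype.card_pos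
  have hc0 : algebraMap K L c ≠ 0 := by simpa using hc
  have c3 : {u : L | u ^ (q ^ 3 + 1) = algebraMap K L c}.ncard = q ^ 3 + 1 := by
    refine ncard_pow_eq (m := q ^ 3 - 1) ?_ (algebraMap_pow_card_pow_sub_one hc 3)
    rw [card_eq_pow_six (K := K) hL, pow_three_add_one_mul q]
  have c1 : {u : L | u ^ (q + 1) = algebraMap K L c}.ncard = q + 1 := by
    refine ncard_pow_eq (m := (q ^ 1 - 1) * (q ^ 4 + q ^ 2 + 1)) ?_ (by
      rw [pow_mul, algebraMap_pow_card_pow_sub_one hc 1, one_pow])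
    obtain ⟨n, hn⟩ : ∃ n, q = n + 1 := ⟨_, (Nat.sub_add_cancel hq1).symm⟩
    rw [card_eq_pow_six (K := K) hL, ← hq, hn, pow_one, Nat.add_sub_cancel]
    symm
    rw [Nat.sub_eq_iff_eq_add (Nat.one_le_pow _ _ (by omega : 0 < n + 1))]
    ring
  have e1 (u : L) : u ^ (q + 1) = frob K 1 u * u := by rw [frob_apply, pow_one, pow_succ]
  have e3 (u : L) : u ^ (q ^ 3 + 1) = frob K 3 u * u := by rw [frob_apply, pow_succ]
  simp only [e1] at c1
  simp only [e3] at c3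
  have fixed2 {u : L} (hu : frob K 1 u * u = algebraMap K L c) : frob K 2 u = u := by
    have h1 := congrArg (frob K 1) hu
    rw [frob_algebraMap, map_mul, frob_frob, ← hu, mul_comm (frob K 1 u) u] at h1
    have hu1 : frob K 1 u ≠ 0 := by
      rintro h
      rw [h, zero_mul] at hu
      exact hc0 hu.symm
    exact mul_right_cancel₀ hu1 h1
  have hsub : {u : L | frob K 1 u * u = algebraMap K L c}
      ⊆ {u : L | frob K 3 u * u = algebraMap K L c} := by
    intro u hu
    rw [Set.mem_ofPred_eq] at hu ⊢
    rw [← frob_frob 1 2, fixed2 hu, hu]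
  have hdiff : {u : L | FrobGeneric K u ∧ frob K 3 u * u = algebraMap K L c}
      = {u : L | frob K 3 u * u = algebraMap K L c}
        \ {u : L | frob K 1 u * u = algebraMap K L c} := by
    ext u
    simp only [Set.mem_ofPred_eq, Set.mem_sdiff]
    constructor
    · rintro ⟨hg, h3⟩
      exact ⟨h3, fun h1 => hg.1 (fixed2 h1)⟩
    · rintro ⟨h3, h1⟩
      refine ⟨⟨fun h => h1 ?_, fun h => h1 ?_⟩, h3⟩
      · rw [← h3, ← frob_frob 1 2, h]
      -- Here u² = c, so σu = ±u. The minus sign gives σ³u = −u, hence u = −u and again σu = u.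
      · rw [h] at h3
        have h1 := congrArg (frob K 1) h3
        rw [map_mul, frob_algebraMap, ← h3] at h1
        rcases mul_self_eq_mul_self_iff.1 h1 with h1 | h1
        · rw [h1, h3]
        · have : frob K 3 u = -u := by
            rw [← frob_frob 2 1, h1, map_neg, ← frob_frob 1 1, h1, map_neg, h1, neg_neg]
          rw [h] at this
          rw [h1, ← this, h3]
  rw [hdiff, Set.ncard_sdiff hsub, c1, c3]
  omega

theorem two_eq_zero_iff_of_algebra (K L : Type*) [Field K] [Field L] [Algebra K L] :
    (2 : L) = 0 ↔ (2 : K) = 0 := by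
  rw [← map_ofNat (algebraMap K L) 2, map_eq_zero]

/-- Additive analogue, with q³ and q solutions. In characteristic 2 with c = 0 every solution is
fixed by σ³, hence the exclusion. -/
theorem ncard_frobGeneric_trace [Fintype L] (hL : Module.finrank K L = 6) {c : K}
    (hc : ¬ ((2 : K) = 0 ∧ c = 0)) :
    {u : L | FrobGeneric K u ∧ frob K 3 u + u = algebraMap K L c}.ncard
      = Fintype.card K ^ 3 - Fintype.card K := by
  have c3 := ncard_frob_add (K := K) (L := L) (i := 3) (n := 1) (by norm_num) hL c
  have c1 := ncard_frob_add (K := K) (L := L) (i := 1) (n := 3) (by norm_num) hL c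
  rw [pow_one] at c1
  have fixed2 {u : L} (hu : frob K 1 u + u = algebraMap K L c) : frob K 2 u = u := by
    have h1 := congrArg (frob K 1) hu
    rw [frob_algebraMap, map_add, frob_frob, ← hu, add_comm (frob K 1 u) u] at h1
    exact add_right_cancel h1
  have hsub : {u : L | frob K 1 u + u = algebraMap K L c}
      ⊆ {u : L | frob K 3 u + u = algebraMap K L c} := by
    intro u hu
    rw [Set.mem_ofPred_eq] at hu ⊢
    rw [← frob_frob 1 2, fixed2 hu, hu]
  have hdiff : {u : L | FrobGeneric K u ∧ frob K 3 u + u = algebraMap K L c}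
      = {u : L | frob K 3 u + u = algebraMap K L c}
        \ {u : L | frob K 1 u + u = algebraMap K L c} := by
    ext u
    simp only [Set.mem_ofPred_eq, Set.mem_sdiff]
    constructor
    · rintro ⟨hg, h3⟩
      exact ⟨h3, fun h1 => hg.1 (fixed2 h1)⟩
    · rintro ⟨h3, h1⟩
      refine ⟨⟨fun h => h1 ?_, fun h => ?_⟩, h3⟩
      · rw [← h3, ← frob_frob 1 2, h]
      · rw [h] at h3
        by_cases h2 : (2 : K) = 0
        · refine hc ⟨h2, ?_⟩
          have h2' : (2 : L) = 0 := (two_eq_zero_iff_of_algebra K L).2 h2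
          rw [← two_mul, h2', zero_mul] at h3
          simpa using h3.symm
        · apply h1
          have h2' : (2 : L) ≠ 0 := (two_eq_zero_iff_of_algebra K L).not.2 h2
          have : frob K 1 u = u := by
            have h1 := congrArg (frob K 1) h3
            rw [map_add, frob_algebraMap, ← h3, ← two_mul, ← two_mul] at h1
            exact mul_left_cancel₀ h2' h1
          rw [this, h3]
  rw [hdiff, Set.ncard_sdiff hsub, c1, c3]

/-- Generic solutions of `a t t³ + b (t + t³) + d = 0`, where `t³` stands for `t ^ (q ^ 3)`. -/
def frobConic (L : Type*) {K : Type*} [Field K] [Fintype K] [Field L] [Algebra K L]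
    (a b d : K) : Set L :=
  {t : L | FrobGeneric K t ∧ algebraMap K L a * (t * frob K 3 t)
    + algebraMap K L b * (t + frob K 3 t) + algebraMap K L d = 0}

theorem FrobGeneric.add_algebraMap {t : L} (ht : FrobGeneric K t) (b : K) :
    FrobGeneric K (t + algebraMap K L b) := by
  simpa [FrobGeneric, frob_algebraMap] using ht

/-- The shift u = t + b turns the conic into the norm equation u · σ³u = b² − d. -/
theorem ncard_frobConic_one [Fintype L] [DecidableEq K] (hL : Module.finrank K L = 6) (b d : K) :
    (frobConic L 1 b d).ncard
      = if d = b ^ 2 then 0 else Fintype.card K ^ 3 - Fintype.card K := by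
  split_ifs with h
  · rw [Set.ncard_eq_zero, Set.eq_empty_iff_forall_notMem]
    rintro t ⟨ht, h0⟩
    subst h
    have : (t + algebraMap K L b) * frob K 3 (t + algebraMap K L b) = 0 := by
      rw [map_add, frob_algebraMap]
      simp only [map_one, map_pow] at h0
      linear_combination h0
    rw [mul_eq_zero, frob_eq_zero, or_self] at this
    have := eq_zero_of_frob_one_ne ht.one_ne (b := 1) (c := b) (by simpa using this)
    exact one_ne_zero this.1
  · have hc : b ^ 2 - d ≠ 0 := fun h0 => h (by linear_combination -h0)
    rw [← ncard_frobGeneric_norm hL hc,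
      ← Set.ncard_image_of_injective _ (add_left_injective (algebraMap K L b))]
    congr 1
    ext u
    constructor
    · rintro ⟨t, ⟨ht, h0⟩, rfl⟩
      refine ⟨ht.add_algebraMap b, ?_⟩
      simp only [map_one, map_add, map_sub, map_pow, frob_algebraMap] at h0 ⊢
      linear_combination h0
    · rintro ⟨hu, h0⟩
      refine ⟨u + algebraMap K L (-b), ⟨hu.add_algebraMap _, ?_⟩, by simp⟩
      simp only [map_one, map_add, map_sub, map_neg, map_pow, frob_algebraMap] at h0 ⊢
      linear_combination h0

theorem ncard_frobConic_zero [Fintype L] [DecidableEq K] (hL : Module.finrank K L = 6) (d : K) :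
    (frobConic L 0 1 d).ncard
      = if (2 : K) = 0 ∧ d = 0 then 0 else Fintype.card K ^ 3 - Fintype.card K := by
  split_ifs with h
  · rw [Set.ncard_eq_zero, Set.eq_empty_iff_forall_notMem]
    rintro t ⟨ht, h0⟩
    obtain ⟨h2, rfl⟩ := h
    have h2' : (2 : L) = 0 := (two_eq_zero_iff_of_algebra K L).2 h2
    apply ht.2
    simp only [map_zero, map_one] at h0
    linear_combination h0 - t * h2'
  · have hc : ¬ ((2 : K) = 0 ∧ -d = 0) := by simpa using h
    rw [← ncard_frobGeneric_trace hL hc]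
    congr 1
    ext t
    simp only [frobConic, Set.mem_ofPred_eq, map_zero, map_one, map_neg]
    refine and_congr_right fun _ => ⟨fun h0 => by linear_combination h0,
      fun h0 => by linear_combination h0⟩

/-- Two non-proportional equations would put t + σ³t or t · σ³t into K, and in fact both, making `t`
quadratic over K. -/
theorem frobConic_unique {t : L} {a b d a' b' d' : K}
    (h : t ∈ frobConic L a b d) (h' : t ∈ frobConic L a' b' d') :
    a * b' = a' * b ∧ a * d' = a' * d ∧ b * d' = b' * d := by
  obtain ⟨ht, h⟩ := h
  obtain ⟨-, h'⟩ := h'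
  set x := t + frob K 3 t with hx
  set y := t * frob K 3 t with hy
  have hne : ¬ (frob K 1 x = x ∧ frob K 1 y = y) := by
    rintro ⟨hx1, hy1⟩
    obtain ⟨s, hs⟩ := frob_one_eq_self_iff.1 hx1
    obtain ⟨n, hn⟩ := frob_one_eq_self_iff.1 hy1
    have := eq_zero_of_frob_two_ne ht.1 (a := 1) (b := -s) (c := n) (by
      rw [map_neg, hs, hn, map_one, hx, hy]; ring)
    exact one_ne_zero this.1
  have ex : algebraMap K L (a * b' - a' * b) * x + algebraMap K L (a * d' - a' * d) = 0 := by
    simp only [map_sub, map_mul]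
    linear_combination algebraMap K L a * h' - algebraMap K L a' * h
  have ey : algebraMap K L (a * b' - a' * b) * y + algebraMap K L (b' * d - b * d') = 0 := by
    simp only [map_sub, map_mul]
    linear_combination algebraMap K L b' * h - algebraMap K L b * h'
  have hD : a * b' - a' * b = 0 := by
    by_contra hD
    exact hne ⟨by_contra fun hx1 => hD (eq_zero_of_frob_one_ne hx1 ex).1,
      by_contra fun hy1 => hD (eq_zero_of_frob_one_ne hy1 ey).1⟩
  rw [hD, map_zero, zero_mul, zero_add, map_eq_zero] at ex ey
  exact ⟨sub_eq_zero.1 hD, sub_eq_zero.1 ex, (sub_eq_zero.1 ey).symm⟩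

/-- Generic `t` that are related to `t ^ (q ^ 3)` by a fractional linear transformation. -/
def selfPaired (K L : Type*) [Field K] [Fintype K] [Field L] [Algebra K L] : Set L :=
  {t : L | FrobGeneric K t ∧ MobiusRel K t (frob K 3 t)}

/-- The conics `a t t³ + b (t + t³) + d = 0` with `(a : b)` normalised to `(1 : b)` or `(0 : 1)`. -/
def normalisedConic (K L : Type*) [Field K] [Fintype K] [Field L] [Algebra K L] :
    (K × K) ⊕ K → Set L :=
  Sum.elim (fun x => frobConic L 1 x.1 x.2) (fun d => frobConic L 0 1 d)

theorem selfPaired_eq_iUnion (h6 : ∀ x : L, frob K 6 x = x) :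
    selfPaired K L = ⋃ i, normalisedConic K L i := by
  ext t
  rw [Set.mem_iUnion]
  constructor
  · rintro ⟨ht, a, b, c, d, hD, h⟩
    have h3 := congrArg (frob K 3) h
    simp only [map_mul, map_add, frob_frob, Nat.reduceAdd, h6, frob_algebraMap] at h3
    -- Since σ³ swaps `t` and σ³t, the transformation is an involution: its trace vanishes and the
    -- relation is symmetric.
    have had : algebraMap K L (a + d) = 0 := by
      have : algebraMap K L (a + d) * (frob K 3 t - t) = 0 := by
        rw [map_add]
        linear_combination h - h3
      exact (mul_eq_zero.1 this).resolve_right (sub_ne_zero.2 ht.2)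
    rw [map_eq_zero] at had
    obtain rfl : d = -a := by linear_combination had
    rw [map_neg] at h
    by_cases hc : c = 0
    · subst hc
      have ha : a ≠ 0 := by rintro rfl; simp at hD
      have ha' : algebraMap K L a ≠ 0 := by simpa using ha
      refine ⟨Sum.inr (b / a), ht, ?_⟩
      simp only [map_zero, map_one, map_div₀] at h ⊢
      field_simp
      linear_combination -h
    · have hc' : algebraMap K L c ≠ 0 := by simpa using hc
      refine ⟨Sum.inl (-a / c, -b / c), ht, ?_⟩
      simp only [map_one, map_div₀, map_neg]
      field_simp
      linear_combination h
  · have key {a b d : K} (h : t ∈ frobConic L a b d) (hab : ¬ (a = 0 ∧ b = 0)) :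
        t ∈ selfPaired K L := by
      refine ⟨h.1, mobiusRel_of_dependent (a := d) (b := b) (c := b) (d := a) h.1.one_ne
        (h.1.frob_three h6).one_ne (by tauto) (by linear_combination h.2)⟩
    rintro ⟨⟨b, d⟩ | d, h⟩
    · exact key h (by simp)
    · exact key h (by simp)

theorem pairwise_disjoint_normalisedConic :
    Pairwise (Function.onFun Disjoint (normalisedConic K L)) := by
  intro i j hij
  rw [Function.onFun, Set.disjoint_left]
  intro t hi hj
  apply hij
  rcases i with ⟨b, d⟩ | d <;> rcases j with ⟨b', d'⟩ | d' <;>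
    have := frobConic_unique hi hj <;> simp_all

/-- There are q(q − 1) nonempty conics with a = 1, and q (odd q) or q − 1 (even q) with a = 0, each
having q³ − q generic points. -/
theorem ncard_selfPaired [Fintype L] [DecidableEq K] (hL : Module.finrank K L = 6) :
    (selfPaired K L).ncard = (Fintype.card K ^ 3 - Fintype.card K)
      * (Fintype.card K ^ 2 - if (2 : K) = 0 then 1 else 0) := by
  classical
  rw [selfPaired_eq_iUnion (frob_six hL), Set.ncard_iUnion_of_finite (fun _ => Set.toFinite _)
    pairwise_disjoint_normalisedConic, finsum_eq_sum_of_fintype, Fintype.sum_sum_type,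
    Fintype.sum_prod_type]
  simp only [normalisedConic, Sum.elim_inl, Sum.elim_inr, ncard_frobConic_one hL,
    ncard_frobConic_zero hL]
  set n := Fintype.card K ^ 3 - Fintype.card K
  have hq : 1 ≤ Fintype.card K := Fintype.card_pos
  have e1 (c : K) : ∑ d : K, (if d = c then 0 else n) = (Fintype.card K - 1) * n := by
    rw [Finset.sum_ite, Finset.sum_const_zero, zero_add, Finset.sum_const, smul_eq_mul,
      Finset.filter_ne', Finset.card_erase_of_mem (Finset.mem_univ _), Finset.card_univ]
  simp only [e1, Finset.sum_const, Finset.card_univ, smul_eq_mul]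
  obtain ⟨m, hm⟩ : ∃ m, Fintype.card K = m + 1 := ⟨_, (Nat.sub_add_cancel hq).symm⟩
  split_ifs with h2
  · simp only [h2, true_and, e1, hm]
    have : (m + 1) ^ 2 - 1 = m ^ 2 + 2 * m := by
      rw [Nat.sub_eq_iff_eq_add (Nat.one_le_pow _ _ (by omega : 0 < m + 1))]
      ring
    rw [this, Nat.add_sub_cancel]
    ring
  · simp only [h2, false_and, if_false, Finset.sum_const, Finset.card_univ, smul_eq_mul, hm]
    rw [Nat.add_sub_cancel, Nat.sub_zero]
    ring

/-- Each fibre of the cross ratio on generic elements consists of one self-paired class or of two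
distinct classes. -/
theorem ncard_fibre_add_ncard_fibre [Fintype L] (hL : Module.finrank K L = 6) {t : L}
    (ht : FrobGeneric K t) :
    {u | FrobGeneric K u ∧ frobRatio K u = frobRatio K t}.ncard
      + {u | u ∈ selfPaired K L ∧ frobRatio K u = frobRatio K t}.ncard
      = 2 * (Fintype.card K ^ 3 - Fintype.card K) := by
  have h6 := frob_six (K := K) hL
  have back {t u : L} (h : MobiusRel K t (frob K 3 u)) : MobiusRel K (frob K 3 t) u := by
    have := h.map_frob 3
    rwa [frob_frob, h6] at this
  have hfib {t : L} (ht : FrobGeneric K t) :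
      {u | FrobGeneric K u ∧ frobRatio K u = frobRatio K t}
        = {u | MobiusRel K t u} ∪ {u | MobiusRel K (frob K 3 t) u} := by
    ext u
    constructor
    · rintro ⟨hu, h⟩
      exact (mobiusRel_of_frobRatio_eq h6 ht hu h.symm).imp id back
    · rintro (h | h)
      · exact ⟨h.frobGeneric ht, h.frobRatio_eq ht.one_ne⟩
      · have ht3 := ht.frob_three h6
        exact ⟨h.frobGeneric ht3, (h.frobRatio_eq ht3.one_ne).trans (frobRatio_frob_three h6 t)⟩
  -- A fibre that is a single class is self-paired and is counted twice by the sum, so both cases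
  -- give the same total.
  by_cases hs : ∃ s ∈ selfPaired K L, frobRatio K s = frobRatio K t
  · obtain ⟨s, ⟨hsg, hs3⟩, hst⟩ := hs
    rw [← hst]
    have e1 : {u | FrobGeneric K u ∧ frobRatio K u = frobRatio K s} = {u | MobiusRel K s u} := by
      rw [hfib hsg, Set.union_eq_left]
      exact fun u hu => hs3.trans hsg.one_ne hu
    have e2 : {u | u ∈ selfPaired K L ∧ frobRatio K u = frobRatio K s} = {u | MobiusRel K s u} := by
      rw [← e1]
      ext u
      refine ⟨fun h => ⟨h.1.1, h.2⟩, fun h => ⟨⟨h.1, ?_⟩, h.2⟩⟩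
      have hsu : MobiusRel K s u := by
        have : u ∈ {u | MobiusRel K s u} := e1 ▸ h
        exact this
      exact (hsu.symm.trans h.1.one_ne hs3).trans h.1.one_ne (hsu.map_frob 3)
    rw [e1, e2, ncard_setOf_mobiusRel hsg.1, two_mul]
  · push Not at hs
    have e2 : {u | u ∈ selfPaired K L ∧ frobRatio K u = frobRatio K t} = ∅ := by
      ext u
      simpa using hs u
    have hdisj : Disjoint {u | MobiusRel K t u} {u | MobiusRel K (frob K 3 t) u} := by
      rw [Set.disjoint_left]
      intro u h1 h2
      exact hs t ⟨ht, h1.trans ht.one_ne h2.symm⟩ rfl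
    rw [e2, Set.ncard_empty, add_zero, hfib ht, Set.ncard_union_eq hdisj,
      ncard_setOf_mobiusRel ht.1, ncard_setOf_mobiusRel (ht.frob_three h6).1, two_mul]

theorem ncard_image_frobRatio [Fintype L] (hL : Module.finrank K L = 6) :
    {t : L | FrobGeneric K t}.ncard + (selfPaired K L).ncard
      = 2 * (Fintype.card K ^ 3 - Fintype.card K)
        * (frobRatio K '' {t : L | FrobGeneric K t}).ncard := by
  classical
  have hsum (S : Set L) (hS : S ⊆ {t | FrobGeneric K t}) : S.ncard
      = ∑ a ∈ (frobRatio K '' {t : L | FrobGeneric K t}).toFinset,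
        {u | u ∈ S ∧ frobRatio K u = a}.ncard := by
    rw [Set.ncard_eq_toFinset_card', Finset.card_eq_sum_card_fiberwise (f := frobRatio K)
      (t := (frobRatio K '' {t : L | FrobGeneric K t}).toFinset)]
    · refine Finset.sum_congr rfl fun a _ => ?_
      rw [Set.ncard_eq_toFinset_card']
      congr 1
      ext u
      simp
    · intro u hu
      have hu : u ∈ S := by simpa using hu
      simpa using ⟨u, hS hu, rfl⟩
  rw [hsum _ subset_rfl, hsum (selfPaired K L) fun u hu => hu.1, ← Finset.sum_add_distrib,
    Finset.sum_congr rfl (g := fun _ => 2 * (Fintype.card K ^ 3 - Fintype.card K)),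
    Finset.sum_const, smul_eq_mul, Set.ncard_eq_toFinset_card', mul_comm]
  intro a ha
  obtain ⟨t, ht, rfl⟩ : ∃ t, FrobGeneric K t ∧ frobRatio K t = a := by simpa using ha
  exact ncard_fibre_add_ncard_fibre hL ht

end Counting

/-! ### The scattered condition as a norm condition, and the size of Γ. -/

section Scattered

variable {K L : Type*} [Field K] [Fintype K] [Field L] [Algebra K L]

theorem fMap_apply (b x : L) : fMap K b x = b * frob K 1 x + frob K 4 x := by
  rw [frob_apply, frob_apply, pow_one]
  rfl

theorem mem_Ub {b : L} {v : L × L} : v ∈ Ub K b ↔ v.2 = fMap K b v.1 :=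
  LinearMap.mem_graph_iff _ _

theorem normSixThree_eq (x : L) : normSixThree K x = frob K 3 x * x := by
  rw [normSixThree, frob_apply, pow_succ]

/-- The points of `U_b` over x and tx span the same L-line iff f_b(tx) = t f_b(x); scatteredness
asks that such ratios t lie in K. -/
theorem isScattered_Ub_iff [Finite L] {b : L} :
    IsScattered K L (Ub K b) ↔
      ∀ t x : L, x ≠ 0 → fMap K b (t * x) = t * fMap K b x → ∃ k : K, algebraMap K L k = t := by
  constructor
  · intro h t x hx htx
    have hv : ((x, fMap K b x) : L × L) ≠ 0 := fun h0 => hx (congrArg Prod.fst h0)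
    obtain ⟨y, hy⟩ := finrank_le_one_iff.1 (h _ hv)
    have m1 : ((x, fMap K b x) : L × L) ∈
        Ub K b ⊓ (Submodule.span L {(x, fMap K b x)}).restrictScalars K :=
      ⟨mem_Ub.2 rfl, Submodule.mem_span_singleton_self _⟩
    have m2 : ((t * x, fMap K b (t * x)) : L × L) ∈
        Ub K b ⊓ (Submodule.span L {(x, fMap K b x)}).restrictScalars K :=
      ⟨mem_Ub.2 rfl, Submodule.mem_span_singleton.2 ⟨t, by rw [htx]; rfl⟩⟩
    obtain ⟨c₁, hc₁⟩ := hy ⟨_, m1⟩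
    obtain ⟨c₂, hc₂⟩ := hy ⟨_, m2⟩
    have e1 : algebraMap K L c₁ * y.1.1 = x := by
      simpa [Algebra.smul_def] using congrArg (fun z => z.1.1) hc₁
    have e2 : algebraMap K L c₂ * y.1.1 = t * x := by
      simpa [Algebra.smul_def] using congrArg (fun z => z.1.1) hc₂
    have hc : algebraMap K L c₁ ≠ 0 := by
      rintro h0
      rw [h0, zero_mul] at e1
      exact hx e1.symm
    have hy0 : y.1.1 ≠ 0 := by
      rintro h0
      rw [h0, mul_zero] at e1
      exact hx e1.symm
    refine ⟨c₂ / c₁, ?_⟩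
    rw [map_div₀, div_eq_iff hc]
    apply mul_right_cancel₀ hy0
    rw [e2, mul_assoc, e1]
  · intro h v hv
    by_cases h0 : ∀ z : ↥(Ub K b ⊓ (Submodule.span L {v}).restrictScalars K), z = 0
    · exact finrank_le_one 0 fun w => ⟨0, by rw [h0 w, smul_zero]⟩
    push Not at h0
    obtain ⟨⟨z, hzU, hzv⟩, hz0⟩ := h0
    obtain ⟨l, hl⟩ := Submodule.mem_span_singleton.1 hzv
    have hl0 : l ≠ 0 := by
      rintro rfl
      rw [zero_smul] at hl
      exact hz0 (Subtype.ext hl.symm)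
    have hz1 : z.1 ≠ 0 := fun hz1 => hz0 (Subtype.ext (Prod.ext hz1 (by
      rw [mem_Ub.1 hzU, hz1, map_zero]; rfl)))
    refine finrank_le_one ⟨z, hzU, hzv⟩ fun ⟨w, hwU, hwv⟩ => ?_
    obtain ⟨m, hm⟩ := Submodule.mem_span_singleton.1 hwv
    have hw : w = (m / l) • z := by
      rw [← hm, ← hl, smul_smul, div_mul_cancel₀ _ hl0]
    obtain ⟨k, hk⟩ := h (m / l) z.1 hz1 (by
      have h1 := mem_Ub.1 hwU
      rw [hw] at h1
      rw [← mem_Ub.1 hzU]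
      exact h1.symm)
    exact ⟨k, Subtype.ext (by
      change k • z = w
      rw [hw, ← hk, algebraMap_smul])⟩

theorem isMaximumScattered_Ub_iff (hL : Module.finrank K L = 6) {b : L} :
    IsMaximumScattered K L (Ub K b) ↔ IsScattered K L (Ub K b) := by
  have : Module.Finite K L := Module.finite_of_finrank_pos (by omega)
  refine and_iff_left ?_
  rw [Module.finrank_prod, hL, Ub, LinearMap.graph_eq_range_prod,
    LinearMap.finrank_range_of_inj (fun x y h => congrArg Prod.fst h), hL]

theorem isScattered_Ub_iff_frobRatio [Fintype L] (hL : Module.finrank K L = 6) {b : L} :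
    IsScattered K L (Ub K b) ↔ ∀ t : L, frob K 1 t ≠ t → normSixThree K b ≠ frobRatio K t := by
  have h6 := frob_six (K := K) hL
  have h7 (x : L) : frob K 7 x = frob K 1 x := by rw [← frob_frob 1 6, h6]
  rw [isScattered_Ub_iff]
  refine forall_congr' fun t => ?_
  rw [← frob_one_eq_self_iff]
  by_cases ht : frob K 1 t = t
  · simp [ht]
  simp only [ht, imp_false, not_false_eq_true, true_imp_iff, Ne]
  rw [← not_exists_not, not_iff_not]
  simp only [Classical.not_imp, not_not, fMap_apply, map_mul]
  have d1 : frob K 1 t - t ≠ 0 := sub_ne_zero.2 ht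
  have d4 : frob K 4 t - frob K 3 t ≠ 0 := by
    rw [sub_ne_zero, show 4 = 3 + 1 from rfl, ← frob_frob, Ne, frob_inj]
    exact ht
  rw [frobRatio, eq_div_iff (mul_ne_zero d1 d4), normSixThree_eq]
  constructor
  · rintro ⟨x, hx, h⟩
    have e : frob K 4 x * (frob K 4 t - t) = -b * (frob K 1 t - t) * frob K 1 x := by
      linear_combination h
    -- Multiplying `e` by its σ³-conjugate eliminates x.
    have e3 := congrArg (frob K 3) e
    simp only [map_mul, map_sub, map_neg, frob_frob, Nat.reduceAdd, h7] at e3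
    have h1 : frob K 1 x ≠ 0 := (frob_eq_zero 1).not.2 hx
    have h4 : frob K 4 x ≠ 0 := (frob_eq_zero 4).not.2 hx
    apply mul_left_cancel₀ (mul_ne_zero h1 h4)
    linear_combination (-frob K 1 x * (frob K 1 t - frob K 3 t)) * e
      + (b * (frob K 1 t - t) * frob K 1 x) * e3
  · intro h
    -- Here the cross ratio is 0, so b = 0 and every nonzero x works.
    by_cases h4 : frob K 4 t = t
    · have hb : b = 0 := by
        rw [h4, sub_self, zero_mul, ← h4, h4, mul_eq_zero] at h
        have := h.resolve_right (mul_ne_zero d1 (by rwa [h4] at d4))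
        rwa [mul_eq_zero, frob_eq_zero, or_self] at this
      exact ⟨1, one_ne_zero, by simp [hb, h4]⟩
    have h40 : frob K 4 t - t ≠ 0 := sub_ne_zero.2 h4
    have h13 : frob K 1 t - frob K 3 t ≠ 0 := by
      rw [← h7, show 7 = 3 + 4 from rfl, ← frob_frob, ← map_sub, Ne, frob_eq_zero]
      exact h40
    -- With y = σx the equation reads σ³y = z y. The hypothesis says that z has norm 1, so z =
    -- y^(q³−1) is solvable (Hilbert 90), and x = σ⁵y.
    set z := -b * (frob K 1 t - t) / (frob K 4 t - t) with hz
    have hz1 : z ^ (Fintype.card K ^ 3 + 1) = 1 := by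
      rw [pow_succ, ← frob_apply, hz]
      simp only [map_div₀, map_mul, map_neg, map_sub, frob_frob, Nat.reduceAdd, h7]
      field_simp
      linear_combination h
    have hq3 : 1 < Fintype.card K ^ 3 := Nat.one_lt_pow (by norm_num) Fintype.one_lt_card
    obtain ⟨y, hy⟩ := exists_pow_eq (d := Fintype.card K ^ 3 - 1)
      (by rw [mul_comm, pow_three_add_one_mul, card_eq_pow_six hL]) (by omega) hz1
    have hy0 : y ≠ 0 := by
      rintro rfl
      rw [zero_pow (by omega)] at hy
      rw [← hy, zero_pow (by omega)] at hz1
      exact zero_ne_one hz1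
    have hy3 : frob K 3 y = z * y := by
      rw [← hy, ← pow_succ, Nat.sub_add_cancel hq3.le, frob_apply]
    refine ⟨frob K 5 y, (frob_eq_zero 5).not.2 hy0, ?_⟩
    have h9 : frob K 9 y = frob K 3 y := by rw [← frob_frob 3 6, h6]
    simp only [frob_frob, Nat.reduceAdd, h6, h9, hy3, hz]
    field_simp
    ring

theorem frobRatio_eq_zero {t : L} (ht : frob K 2 t = t) : frobRatio K t = 0 := by
  rw [frobRatio, ← frob_frob 2 2, ht, ht, sub_self, zero_mul, zero_div]

theorem frobRatio_eq_one {t : L} (ht1 : frob K 1 t ≠ t) (ht : frob K 3 t = t) :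
    frobRatio K t = 1 := by
  have h4 : frob K 4 t = frob K 1 t := by rw [← frob_frob 1 3, ht]
  rw [frobRatio, h4, ht, div_self]
  exact mul_ne_zero (sub_ne_zero.2 ht1) (sub_ne_zero.2 ht1)

theorem FrobGeneric.frobRatio_ne_zero (h6 : ∀ x : L, frob K 6 x = x) {t : L}
    (ht : FrobGeneric K t) : frobRatio K t ≠ 0 := by
  refine div_ne_zero (mul_ne_zero (sub_ne_zero.2 (ht.four_ne h6)) ?_)
    (mul_ne_zero (sub_ne_zero.2 ht.one_ne) ?_)
  · rw [sub_ne_zero, show 3 = 1 + 2 from rfl, ← frob_frob, Ne, frob_inj]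
    exact ht.1.symm
  · rw [sub_ne_zero, show 4 = 3 + 1 from rfl, ← frob_frob, Ne, frob_inj]
    exact ht.one_ne

theorem FrobGeneric.frobRatio_ne_one {t : L} (ht : FrobGeneric K t) : frobRatio K t ≠ 1 := by
  intro h
  have d1 : frob K 1 t - t ≠ 0 := sub_ne_zero.2 ht.one_ne
  have d4 : frob K 4 t - frob K 3 t ≠ 0 := by
    rw [sub_ne_zero, show 4 = 3 + 1 from rfl, ← frob_frob, Ne, frob_inj]
    exact ht.one_ne
  rw [frobRatio, div_eq_one_iff_eq (mul_ne_zero d1 d4)] at h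
  have : (frob K 4 t - frob K 1 t) * (frob K 3 t - t) = 0 := by linear_combination -h
  rcases mul_eq_zero.1 this with h | h
  · rw [sub_eq_zero, show 4 = 1 + 3 from rfl, ← frob_frob, frob_inj] at h
    exact ht.2 h
  · exact ht.2 (sub_eq_zero.1 h)

theorem exists_frob_fixed [Fintype L] {i n : ℕ} (hi : 1 < i) (hL : Module.finrank K L = i * n) :
    ∃ t : L, frob K i t = t ∧ frob K 1 t ≠ t := by
  have h1 := ncard_frob_fixed (K := K) (L := L) (i := 1) (n := i * n) one_pos (by rw [hL, one_mul])
  have hi' := ncard_frob_fixed (K := K) (L := L) (by omega) hL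
  have hlt : Fintype.card K ^ 1 < Fintype.card K ^ i :=
    Nat.pow_lt_pow_right Fintype.one_lt_card hi
  rw [← h1, ← hi'] at hlt
  obtain ⟨t, ht, ht'⟩ := Set.exists_mem_notMem_of_ncard_lt_ncard hlt
  exact ⟨t, ht, ht'⟩

theorem image_frobRatio_eq [Fintype L] (hL : Module.finrank K L = 6) :
    frobRatio K '' {t : L | frob K 1 t ≠ t}
      = insert 0 (insert 1 (frobRatio K '' {t : L | FrobGeneric K t})) := by
  obtain ⟨t₂, h₂, h₂'⟩ := exists_frob_fixed (K := K) (L := L) (i := 2) (n := 3) (by norm_num) hL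
  obtain ⟨t₃, h₃, h₃'⟩ := exists_frob_fixed (K := K) (L := L) (i := 3) (n := 2) (by norm_num) hL
  ext w
  constructor
  · rintro ⟨t, ht, rfl⟩
    by_cases h2 : frob K 2 t = t
    · exact Or.inl (frobRatio_eq_zero h2)
    by_cases h3 : frob K 3 t = t
    · exact Or.inr (Or.inl (frobRatio_eq_one ht h3))
    · exact Or.inr (Or.inr ⟨t, ⟨h2, h3⟩, rfl⟩)
  · rintro (rfl | rfl | ⟨t, ht, rfl⟩)
    · exact ⟨t₂, h₂', frobRatio_eq_zero h₂⟩
    · exact ⟨t₃, h₃', frobRatio_eq_one h₃' h₃⟩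
    · exact ⟨t, ht.one_ne, rfl⟩

theorem exists_normSixThree_eq [Fintype L] (hL : Module.finrank K L = 6) {w : L}
    (hw : frob K 3 w = w) : ∃ b : L, normSixThree K b = w := by
  by_cases h0 : w = 0
  · exact ⟨0, by rw [h0, normSixThree, zero_pow (by omega)]⟩
  refine exists_pow_eq (m := Fintype.card K ^ 3 - 1)
    (by rw [pow_three_add_one_mul, card_eq_pow_six hL]) (by omega) ?_
  apply mul_right_cancel₀ h0
  rw [← pow_succ, Nat.sub_add_cancel (Nat.one_le_pow _ _ Fintype.card_pos), ← frob_apply, hw,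
    one_mul]

theorem frob_three_normSixThree (hL : Module.finrank K L = 6) (b : L) :
    frob K 3 (normSixThree K b) = normSixThree K b := by
  rw [normSixThree_eq, map_mul, frob_frob, frob_six hL, mul_comm]

theorem gammaSet_eq [Fintype L] (hL : Module.finrank K L = 6) :
    GammaSet K L = {w | frob K 3 w = w} \ frobRatio K '' {t : L | frob K 1 t ≠ t} := by
  ext w
  constructor
  · rintro ⟨b, hb, rfl⟩
    rw [isMaximumScattered_Ub_iff hL, isScattered_Ub_iff_frobRatio hL] at hb
    exact ⟨frob_three_normSixThree hL b, fun ⟨t, ht, h⟩ => hb t ht h.symm⟩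
  · rintro ⟨hw, hA⟩
    obtain ⟨b, rfl⟩ := exists_normSixThree_eq hL hw
    refine ⟨b, ?_, rfl⟩
    rw [isMaximumScattered_Ub_iff hL, isScattered_Ub_iff_frobRatio hL]
    exact fun t ht h => hA ⟨t, ht, h.symm⟩

/-- Doubling avoids the floor; the correction by parity of q comes from the characteristic-2
exception among the conics. -/
theorem two_mul_ncard_gammaSet [Fintype L] [DecidableEq K] (hL : Module.finrank K L = 6) :
    (2 * (GammaSet K L).ncard : ℤ) = ((Fintype.card K : ℤ) ^ 2 + Fintype.card K + 1)
      * (Fintype.card K - 2) - if (2 : K) = 0 then 0 else 1 := by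
  have h6 := frob_six (K := K) hL
  have hsub : frobRatio K '' {t : L | frob K 1 t ≠ t} ⊆ {w | frob K 3 w = w} := by
    rintro _ ⟨t, -, rfl⟩
    exact frob_three_frobRatio h6 t
  have hG := Set.ncard_sdiff_add_ncard_of_subset hsub
  have h0 : (0 : L) ∉ insert 1 (frobRatio K '' {t : L | FrobGeneric K t}) := by
    rintro (h | ⟨t, ht, h⟩)
    · exact zero_ne_one h
    · exact ht.frobRatio_ne_zero h6 h
  have h1 : (1 : L) ∉ frobRatio K '' {t : L | FrobGeneric K t} := by
    rintro ⟨t, ht, h⟩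
    exact ht.frobRatio_ne_one h
  rw [← gammaSet_eq hL, image_frobRatio_eq hL, Set.ncard_insert_of_notMem h0,
    Set.ncard_insert_of_notMem h1,
    ncard_frob_fixed (K := K) (L := L) (i := 3) (n := 2) (by norm_num) hL] at hG
  have hI := ncard_image_frobRatio (K := K) hL
  have hT := ncard_frobGeneric (K := K) hL
  rw [ncard_selfPaired hL] at hI
  have hq : 1 < Fintype.card K := Fintype.one_lt_card
  have hq3 : Fintype.card K ≤ Fintype.card K ^ 3 := Nat.le_self_pow (by norm_num) _
  have hq2 : (if (2 : K) = 0 then 1 else 0) ≤ Fintype.card K ^ 2 := by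
    split_ifs
    · exact Nat.one_le_pow _ _ (by omega)
    · exact Nat.zero_le _
  zify [hq3, hq2] at hI hT hG hq
  generalize (Fintype.card K : ℤ) = q at *
  generalize ((frobRatio K '' {t : L | FrobGeneric K t}).ncard : ℤ) = I at *
  generalize ({t : L | FrobGeneric K t}.ncard : ℤ) = T at *
  have hpos : q ^ 3 - q ≠ 0 := by
    have : q ^ 3 - q = q * (q - 1) * (q + 1) := by ring
    rw [this]
    have : q - 1 ≠ 0 := by omega
    have : q + 1 ≠ 0 := by omega
    have : q ≠ 0 := by omega
    positivity
  have hI' : 2 * I = q ^ 3 + q - 1 + (q ^ 2 - if (2 : K) = 0 then 1 else 0) := by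
    apply mul_left_cancel₀ hpos
    linear_combination hT - hI
  split_ifs at hI' ⊢ <;> linear_combination 2 * hG - hI'

end Scattered

/-! ### Equivalence classes of the subspaces and the lower bound. -/

section Equivalence

variable {K L : Type*} [Field K] [Fintype K] [Field L] [Algebra K L]

theorem fMap_ringEquiv (σ : L ≃+* L) (b x : L) : σ (fMap K b x) = fMap K (σ b) (σ x) := by
  simp only [fMap_apply, frob_apply, map_add, map_mul, map_pow]

/-- Up to an automorphism of `L`, the norm of `b` over `𝔽_{q³}` is an invariant of the
`ΓL`-equivalence class of `U_b`. -/
theorem exists_normSixThree_eq_of_gammaLEquivalent (hL : Module.finrank K L = 6) {b c : L}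
    (h : GammaLEquivalent K L (Ub K b) (Ub K c)) :
    ∃ σ : L ≃+* L, normSixThree K c = σ (normSixThree K b) := by
  have h6 := frob_six (K := K) hL
  have hs (i) (x : L) : frob K (i + 6) x = frob K i x := by rw [← frob_frob, h6]
  have h7 (x : L) : frob K 7 x = frob K 1 x := hs 1 x
  have h8 (x : L) : frob K 8 x = frob K 2 x := hs 2 x
  obtain ⟨σ, φ, hφ, himg⟩ := h
  refine ⟨σ, ?_⟩
  obtain ⟨α, γ, hαγ⟩ : ∃ α γ, φ (1, 0) = (α, γ) := ⟨_, _, rfl⟩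
  obtain ⟨β, δ, hβδ⟩ : ∃ β δ, φ (0, 1) = (β, δ) := ⟨_, _, rfl⟩
  have hxy (x y : L) : φ (x, y) = (σ x * α + σ y * β, σ x * γ + σ y * δ) := by
    have : ((x, y) : L × L) = x • (1, 0) + y • (0, 1) := by simp
    rw [this, map_add, hφ, hφ, hαγ, hβδ]
    simp
  have key (z : L) : z * γ + fMap K (σ b) z * δ = fMap K c (z * α + fMap K (σ b) z * β) := by
    have hmem : φ (σ.symm z, fMap K b (σ.symm z)) ∈ (Ub K c : Set (L × L)) := by
      rw [← himg]
      exact ⟨_, mem_Ub.2 rfl, rfl⟩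
    have := mem_Ub.1 hmem
    rwa [hxy, fMap_ringEquiv, σ.apply_symm_apply] at this
  have hfin : Module.Finite K L := Module.finite_of_finrank_pos (by omega)
  let B := Module.finBasisOfFinrankEq K L hL
  set d := σ b with hd
  -- `key` is an identity of q-polynomials of degree below q⁶ in z, valid on a basis of L, so all
  -- six coefficients vanish.
  have hc := linearIndependent_frob B.linearIndependent
    (c := ![γ, δ * d - c * frob K 1 α, -(c * frob K 1 β * frob K 1 d + frob K 4 β), 0,
      δ - frob K 4 α, -(c * frob K 1 β + frob K 4 β * frob K 4 d)]) (fun j => by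
        have := key (B j)
        simp only [fMap_apply, map_add, map_mul, frob_frob, Nat.reduceAdd, h8] at this
        simp only [Fin.sum_univ_six, Matrix.cons_val, Fin.isValue, frob_zero,
          Fin.coe_ofNat_eq_mod, Nat.reduceMod]
        linear_combination this)
  have hγ : γ = 0 := congrFun hc 0
  have e1 : δ * d - c * frob K 1 α = 0 := congrFun hc 1
  have e4 : δ - frob K 4 α = 0 := congrFun hc 4
  have hα : α ≠ 0 := by
    rintro rfl
    rw [hγ] at hαγ
    have := (map_eq_zero_iff φ φ.injective).1 hαγ
    simp at this
  -- Because σ³ swaps σα and σ⁴α, these have the same norm to 𝔽_{q³}; taking norms in `e` gives N(c)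
  -- = N(d).
  have e : c * frob K 1 α = frob K 4 α * d := by linear_combination -e1 + d * e4
  have e3 := congrArg (frob K 3) e
  simp only [map_mul, frob_frob, Nat.reduceAdd, h7] at e3
  have hN : σ (normSixThree K b) = normSixThree K d := by
    simp only [normSixThree, map_pow, hd]
  rw [hN, normSixThree_eq, normSixThree_eq]
  apply mul_left_cancel₀ (mul_ne_zero ((frob_eq_zero (K := K) 1).not.2 hα)
    ((frob_eq_zero (K := K) 4).not.2 hα))
  linear_combination (frob K 3 c * frob K 4 α) * e + frob K 4 α * d * e3

theorem exists_ringEquiv_eq_pow [Finite L] {p : ℕ} [Fact p.Prime] [CharP L p] (σ : L ≃+* L) :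
    ∃ n : ℕ, ∀ x, σ x = x ^ p ^ n := by
  let _ := ZMod.algebra L p
  have hσ : ∀ r : ZMod p, σ (algebraMap (ZMod p) L r) = algebraMap (ZMod p) L r := fun r =>
    RingHom.congr_fun (Subsingleton.elim ((σ : L →+* L).comp (algebraMap (ZMod p) L)) _) r
  obtain ⟨n, hn⟩ := (FiniteField.bijective_frobeniusAlgEquivOfAlgebraic_pow (ZMod p) L).2
    (AlgEquiv.ofRingEquiv hσ)
  refine ⟨n, fun x => ?_⟩
  have := DFunLike.congr_fun hn x
  simp only [AlgEquiv.coe_pow, FiniteField.coe_frobeniusAlgEquivOfAlgebraic_iterate, ZMod.card]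
    at this
  exact this.symm

instance finite_maxScatteredUb [Finite L] : Finite (MaxScatteredUb K L) := by
  refine Finite.of_surjective
    (fun b : {b : L // IsMaximumScattered K L (Ub K b)} => ⟨Ub K b.1, b.2, b.1, rfl⟩) ?_
  rintro ⟨_, hU, b, rfl⟩
  exact ⟨⟨b, hU⟩, rfl⟩

/-- Sending each norm in Γ to the class of one chosen `U_b` has fibres of size at most 3e:
automorphisms are p-power maps, and on 𝔽_{q³} these depend only on the exponent mod 3e. -/
theorem ncard_gammaSet_le [Fintype L] {p e : ℕ} (hp : p.Prime) (hq : Fintype.card K = p ^ e)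
    (hL : Module.finrank K L = 6) :
    (GammaSet K L).ncard ≤ 3 * e * numInequivalent K L := by
  classical
  have := Fact.mk hp
  have hpK : CharP K p := charP_of_card_eq_prime_pow hq
  have hpL : CharP L p := charP_of_injective_algebraMap (algebraMap K L).injective p
  have he : 0 < 3 * e := by
    have : e ≠ 0 := by
      rintro rfl
      exact (Fintype.one_lt_card (α := K)).ne' hq
    omega
  have hpow {w : L} (hw : frob K 3 w = w) (n : ℕ) : w ^ p ^ n = w ^ p ^ (n % (3 * e)) := by
    rw [frob_apply, hq, ← pow_mul, mul_comm e 3] at hw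
    have hk (k : ℕ) : w ^ p ^ (3 * e * k) = w := by
      induction k with
      | zero => simp
      | succ k ih => rw [mul_add, pow_add, pow_mul, ih, mul_one, hw]
    conv_lhs => rw [← Nat.div_add_mod n (3 * e), pow_add, pow_mul, hk]
  choose β hβ hβN using fun w : GammaSet K L => w.2
  let Q := Quotient (gammaLSetoid K L)
  have : Fintype Q := Fintype.ofFinite _
  let g : GammaSet K L → Q := fun w => Quotient.mk _ ⟨Ub K (β w), hβ w, β w, rfl⟩
  have hfix (w : GammaSet K L) : frob K 3 w.1 = w := by
    rw [← hβN w]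
    exact frob_three_normSixThree hL _
  have hle := Finset.card_le_mul_card_image (f := g) Finset.univ (3 * e) (by
    intro x hx
    obtain ⟨w₀, -, rfl⟩ := Finset.mem_image.1 hx
    rw [← Finset.card_map (Function.Embedding.subtype _)]
    refine (Finset.card_le_card (t := (Finset.range (3 * e)).image fun n => w₀.1 ^ p ^ n) ?_).trans
      (Finset.card_image_le.trans (Finset.card_range _).le)
    intro w hw
    obtain ⟨w, hw', rfl⟩ := Finset.mem_map.1 hw
    have heq : g w₀ = g w := (Finset.mem_filter.1 hw').2.symm
    obtain ⟨σ, hσ⟩ := exists_normSixThree_eq_of_gammaLEquivalent hL (Quotient.exact heq)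
    obtain ⟨n, hn⟩ := exists_ringEquiv_eq_pow (p := p) σ
    rw [hβN, hβN, hn, hpow (hfix w₀)] at hσ
    exact Finset.mem_image.2 ⟨_, Finset.mem_range.2 (Nat.mod_lt _ he), hσ.symm⟩)
  rw [Finset.card_univ, ← Nat.card_eq_fintype_card, Nat.card_coe_set_eq] at hle
  refine hle.trans (Nat.mul_le_mul_left _ ?_)
  rw [numInequivalent, Nat.card_eq_fintype_card]
  exact Finset.card_le_univ _

theorem ncard_gammaSet_eq_floor [Fintype L] (hL : Module.finrank K L = 6) :
    ((GammaSet K L).ncard : ℤ) =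
      ⌊((Fintype.card K : ℚ) ^ 2 + Fintype.card K + 1) * (Fintype.card K - 2) / 2⌋ := by
  classical
  have h := congrArg (Int.cast : ℤ → ℚ) (two_mul_ncard_gammaSet (K := K) hL)
  symm
  rw [Int.floor_eq_iff]
  push_cast at h ⊢
  -- The number before rounding exceeds |Γ| by 0 for even q and by 1/2 for odd q.
  split_ifs at h <;> constructor <;> linarith

end Equivalence

theorem mainTheorem5 (p e q : ℕ) (hp : p.Prime) (hq : q = p ^ e)
    (K L : Type*) [Field K] [Fintype K] [Field L] [Algebra K L]
    (hK : Fintype.card K = q) (hL : Module.finrank K L = 6) :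
    ((GammaSet K L).ncard : ℤ) = ⌊((q : ℚ) ^ 2 + q + 1) * (q - 2) / 2⌋ ∧
      (⌊((q : ℚ) ^ 2 + q + 1) * (q - 2) / 2⌋ : ℚ) / (3 * e) ≤ numInequivalent K L := by
  have := Module.finite_of_finrank_pos (R := K) (M := L) (by omega)
  have := Module.finite_of_finite K (M := L)
  have := Fintype.ofFinite L
  have hfloor := ncard_gammaSet_eq_floor (K := K) hL
  have hle := ncard_gammaSet_le hp (hK.trans hq) hL
  rw [hK] at hfloor
  refine ⟨hfloor, div_le_of_le_mul₀ (by positivity) (by positivity) ?_⟩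
  rw [← hfloor]
  exact_mod_cast hle.trans_eq (mul_comm _ _)
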